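/- Let $\mathrm{Man}$ be the category of finite-dimensional smooth manifolds (Hausdorff, second countable) with its tangent structure: the tangent functor $T$, projection $p$, zero section $0$, fibrewise addition $+_p$, vertical lift $l:TM\to T^2M$ and canonical flip $c:T^2M\to T^2M$. A *smooth involution algebra* is an involution algebroid in $\mathrm{Man}$ over the terminal object $1$. As $T(1)=1$, this is a manifold $A$ with smooth maps making it an abelian group (with zero $0_A$), with a smooth lift $\lambda:A\to TA$ such that $p\lambda=0_A$, $\lambda(a+b)=\lambda(a)+_p\lambda(b)=T(+)(\lambda(a),\lambda(b))$, $\lambda(0_A)$ is the zero vector at $0_A$, $T(\lambda)\lambda=l\lambda$, and $\mu:A\times A\to TA$, $\mu(a,b)=T(+)(0a,\lambda b)$, is a diffeomorphism, together with a smooth map $\alpha:A\times TA\to TA$ such that, for $v\in A$, $w\in TA$, $x\in T^2A$, $$p\,\alpha(v,w)=v,\qquad T(\alpha)(0v,cT(\lambda)w)=l\,\alpha(v,w),\qquad T(\alpha)(\lambda v,l w)=cT(\lambda)\alpha(v,w),$$ $$\alpha(0_A,\lambda v)=\lambda v,\qquad \alpha(pw,\alpha(v,w))=w,$$ $$T(\alpha)(\alpha(v,w),x)=c\,T(\alpha)\bigl(\alpha(v,px),\,c\,T(\alpha)(w,cx)\bigr).$$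 A morphism $f:A\to B$ is a smooth map that is linear, $T(f)\lambda_A=\lambda_Bf$, and satisfies $T(f)\,\alpha_A=\alpha_B\,(f\times T(f))$. Let $\mathrm{SInvAlg}$ be the resulting category and $\mathrm{LieAlg}$ the category of finite-dimensional real Lie algebras. Under $\mu$ we identify $TA$ with $A\times A$, and write $\pi_1:TA\to A$ for the second component of $\mu^{-1}$. **Corollary.** There is a functor $\iota:\mathrm{LieAlg}\to\mathrm{SInvAlg}$, the identity on arrows, which sends a Lie algebra $A$ to the vector space $A$, regarded as a smooth manifold with $\lambda(a)=(0,a)$ under $TA\cong A\times A$, with $$\alpha(v,w_H,w_V)=(v,\;w_V+[v,w_H]),$$ and $\iota$ is an equivalence of categories. Moreover, for every smooth involution algebra $A$ with the scalar multiplication determined by $\lambda(rx)=r\lambda(x)$, the formula $[x,y]=\pi_1\alpha(x,y,0)$ defines a Lie algebra structure $r(A)$ on $A$; this gives a functor $r:\mathrm{SInvAlg}\to\mathrm{LieAlg}$, the identity on arrows, such that $r\circ\iota=\mathrm{id}$, and the identity maps $\iota(r(A))\to A$ form a natural isomorphism $\iota\circ r\cong\mathrm{id}$. -/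

import Mathlib

open CategoryTheory
open scoped Manifold ContDiff

/-! ### The tangent structure of the category of smooth manifolds -/

namespace TangentStr

section

universe u v w

variable {E : Type u} [NormedAddCommGroup E] [NormedSpace ℝ E]
  {H : Type v} [TopologicalSpace H] {I : ModelWithCorners ℝ E H}
  {M : Type w} [TopologicalSpace M] [ChartedSpace H M]

/-- The coordinates of a tangent vector, in the preferred chart at its base point. -/
def vec (t : TangentBundle I M) : E := t.2

variable (I) in
/-- The tangent vector at `x` with coordinates `v` in the preferred chart at `x`. -/
def tmk (x : M) (v : E) : TangentBundle I M := ⟨x, v⟩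

variable (I) in
/-- The zero section `0 : M → TM`. -/
def zero (x : M) : TangentBundle I M := tmk I x 0

/-- The fibrewise addition `+ : TM ×_M TM → TM`. It is only applied to two tangent vectors that
have the same base point. -/
def add (s t : TangentBundle I M) : TangentBundle I M := tmk I s.1 (vec s + vec t)

/-- The fibrewise scalar multiplication on `TM`. -/
noncomputable def smul (r : ℝ) (t : TangentBundle I M) : TangentBundle I M := tmk I t.1 (r • vec t)

variable [IsManifold I ∞ M]

/-- The vertical lift `l : TM → T(TM)`, in coordinates `(x, v) ↦ (x, 0; 0, v)`. -/
noncomputable def vlift (t : TangentBundle I M) : TangentBundle I.tangent (TangentBundle I M) :=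
  tmk I.tangent (tmk I t.1 0) ((0 : E), vec t)

/-- The canonical flip `c : T(TM) → T(TM)`, in coordinates `(x, v; w₁, w₂) ↦ (x, w₁; v, w₂)`.
The preferred chart of `TM` at a tangent vector is the one induced by the preferred chart of `M`
at its base point `x`, so that all the coordinates refer to the preferred chart of `M` at `x`. -/
noncomputable def cflip (t : TangentBundle I.tangent (TangentBundle I M)) :
    TangentBundle I.tangent (TangentBundle I M) :=
  let w : E × E := vec t
  tmk I.tangent (tmk I t.1.1 w.1) (vec t.1, w.2)

end

end TangentStr

open TangentStr

/-! ### Differential objects and involution algebras in the category of smooth manifolds -/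

section

universe u v

variable (E : Type u) [NormedAddCommGroup E] [NormedSpace ℝ E]
  (A : Type v) [TopologicalSpace A] [ChartedSpace E A]

/-- The tangent map `T(+) : TA × TA → TA` of the addition `A × A → A`, precomposed with the
canonical identification of `TA × TA` with `T(A × A)`. -/
noncomputable def tangentAdd [AddCommGroup A] [IsManifold 𝓘(ℝ, E) ∞ A]
    (s t : TangentBundle 𝓘(ℝ, E) A) : TangentBundle 𝓘(ℝ, E) A :=
  tangentMap (𝓘(ℝ, E).prod 𝓘(ℝ, E)) 𝓘(ℝ, E) (fun q : A × A => q.1 + q.2)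
    ((equivTangentBundleProd 𝓘(ℝ, E) A 𝓘(ℝ, E) A).symm (s, t))

/-- A differential object in the category of smooth manifolds: a differential bundle over the
terminal object `1`, i.e. a commutative group object `A` with a lift `λ : A → TA`. As
`T(1) = 1`, fibre products over the base are products, the zero section is the point `0 : A`, and
the equaliser condition says that `μ : A × A → TA`, `μ(a, b) = 0a + λb`, is a diffeomorphism. -/
structure DifferentialObject [AddCommGroup A] [LieAddGroup 𝓘(ℝ, E) ∞ A] where
  /-- the lift `λ` -/
  lift : A → TangentBundle 𝓘(ℝ, E) A
  contMDiff_lift : ContMDiff 𝓘(ℝ, E) 𝓘(ℝ, E).tangent ∞ lift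
  /-- `(λ, ξ)` is an additive bundle morphism from `A → 1` to `p : TA → A`. -/
  proj_lift : ∀ a, (lift a).proj = 0
  lift_zero : lift 0 = TangentStr.zero 𝓘(ℝ, E) (0 : A)
  lift_add : ∀ a b, lift (a + b) = TangentStr.add (lift a) (lift b)
  /-- `(λ, 0)` is an additive bundle morphism from `A → 1` to `TA → T(1) = 1`; the zero of the
  latter is `0 : T_0 A`, which is `lift_zero` again. -/
  lift_add' : ∀ a b, lift (a + b) = tangentAdd E A (lift a) (lift b)
  /-- `T(λ)λ = lλ` -/
  lift_lift : ∀ a, tangentMap 𝓘(ℝ, E) 𝓘(ℝ, E).tangent lift (lift a) = vlift (lift a)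
  /-- the vertical part: the second component of `μ⁻¹ : TA → A × A`, the first one being the
  projection `p` -/
  vert : TangentBundle 𝓘(ℝ, E) A → A
  contMDiff_vert : ContMDiff 𝓘(ℝ, E).tangent 𝓘(ℝ, E) ∞ vert
  mu_vert : ∀ t, tangentAdd E A (TangentStr.zero 𝓘(ℝ, E) t.proj) (lift (vert t)) = t
  vert_mu : ∀ a b, vert (tangentAdd E A (TangentStr.zero 𝓘(ℝ, E) a) (lift b)) = b

variable {E A} in
/-- The isomorphism `μ : A × A → TA`, `μ(a, b) = 0a + λb`. -/
noncomputable def DifferentialObject.mu [AddCommGroup A] [LieAddGroup 𝓘(ℝ, E) ∞ A]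
    (D : DifferentialObject E A) (a b : A) : TangentBundle 𝓘(ℝ, E) A :=
  tangentAdd E A (TangentStr.zero 𝓘(ℝ, E) a) (D.lift b)

/-- The tangent map `T(α) : TA × T(TA) → T(TA)` of a map `α : A × TA → TA`, precomposed with the
canonical identification of `TA × T(TA)` with `T(A × TA)`. -/
noncomputable def tangentFlip [IsManifold 𝓘(ℝ, E) ∞ A]
    (α : A × TangentBundle 𝓘(ℝ, E) A → TangentBundle 𝓘(ℝ, E) A)
    (s : TangentBundle 𝓘(ℝ, E) A)
    (t : TangentBundle 𝓘(ℝ, E).tangent (TangentBundle 𝓘(ℝ, E) A)) :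
    TangentBundle 𝓘(ℝ, E).tangent (TangentBundle 𝓘(ℝ, E) A) :=
  tangentMap (𝓘(ℝ, E).prod 𝓘(ℝ, E).tangent) 𝓘(ℝ, E).tangent α
    ((equivTangentBundleProd 𝓘(ℝ, E) A 𝓘(ℝ, E).tangent (TangentBundle 𝓘(ℝ, E) A)).symm (s, t))

/-- The structure of an involution algebroid over the terminal object `1` on the manifold `A`.
As `T(1) = 1`, the anchor `A → T(1)` is the unique map, the prolongation `A ×_{T(1)} TA` is
`A × TA`, and the axiom on the target of `α` is an equation between maps into `T²(1) = 1`. -/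
structure InvolutionStructure [AddCommGroup A] [LieAddGroup 𝓘(ℝ, E) ∞ A]
    extends DifferentialObject E A where
  /-- the flip `α` -/
  flip : A × TangentBundle 𝓘(ℝ, E) A → TangentBundle 𝓘(ℝ, E) A
  contMDiff_flip :
    ContMDiff (𝓘(ℝ, E).prod 𝓘(ℝ, E).tangent) 𝓘(ℝ, E).tangent ∞ flip
  /-- `(α, id)` is a linear bundle morphism from `π₀` (with lift `0 × cT(λ)`) to `p : TA → A`
  (with lift `l`). -/
  proj_flip : ∀ v w, (flip (v, w)).proj = v
  flip_linear : ∀ v w,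
    tangentFlip E A flip (TangentStr.zero 𝓘(ℝ, E) v)
      (cflip (tangentMap 𝓘(ℝ, E) 𝓘(ℝ, E).tangent lift w)) = vlift (flip (v, w))
  /-- `(α, !)` is a linear bundle morphism from `pπ₁` (with lift `λ × l`) to `TA → T(1)`
  (with lift `cT(λ)`). -/
  flip_linear' : ∀ v w,
    tangentFlip E A flip (lift v) (vlift w) =
      cflip (tangentMap 𝓘(ℝ, E) 𝓘(ℝ, E).tangent lift (flip (v, w)))
  /-- `α(ξπ, λ) = λ` -/
  flip_unit : ∀ v, flip (0, lift v) = lift v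
  /-- `α(pπ₁, α) = π₁` -/
  flip_inv : ∀ v w, flip (w.proj, flip (v, w)) = w
  /-- `T(α)(α(v, w), x) = cT(α)(α(v, px), cT(α)(w, cx))` -/
  flip_flip : ∀ (v : A) (w : TangentBundle 𝓘(ℝ, E) A)
      (x : TangentBundle 𝓘(ℝ, E).tangent (TangentBundle 𝓘(ℝ, E) A)),
    tangentFlip E A flip (flip (v, w)) x =
      cflip (tangentFlip E A flip (flip (v, x.proj))
        (cflip (tangentFlip E A flip w (cflip x))))

end

universe u

/-- A smooth involution algebra: an involution algebroid over the terminal object in the category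
of (finite-dimensional, Hausdorff, second countable) smooth manifolds. -/
structure SInvAlg where
  /-- the total space -/
  carrier : Type u
  /-- the model space of the total space -/
  model : Type u
  [normedAddCommGroup : NormedAddCommGroup model]
  [normedSpace : NormedSpace ℝ model]
  [finiteDimensional : FiniteDimensional ℝ model]
  [topologicalSpace : TopologicalSpace carrier]
  [t2Space : T2Space carrier]
  [secondCountable : SecondCountableTopology carrier]
  [chartedSpace : ChartedSpace model carrier]
  [addCommGroup : AddCommGroup carrier]
  [lieAddGroup : LieAddGroup 𝓘(ℝ, model) ∞ carrier]
  /-- the structure of an involution algebroid over the terminal object -/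
  str : InvolutionStructure model carrier

namespace SInvAlg

attribute [instance] normedAddCommGroup normedSpace finiteDimensional topologicalSpace t2Space
  secondCountable chartedSpace addCommGroup lieAddGroup

/-- The tangent bundle of the total space. -/
abbrev T (X : SInvAlg.{u}) : Type u := TangentBundle 𝓘(ℝ, X.model) X.carrier

/-- A morphism of involution algebras: a smooth map that is linear, i.e. preserves the lift (it then
also preserves the addition), and that commutes with the flips. The base maps `1 → 1` and the
compatibility with the anchors carry no information. -/
@[ext]
structure Hom (X Y : SInvAlg.{u}) where
  /-- the underlying map -/
  toFun : X.carrier → Y.carrier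
  contMDiff_toFun : ContMDiff 𝓘(ℝ, X.model) 𝓘(ℝ, Y.model) ∞ toFun
  map_lift : ∀ x,
    tangentMap 𝓘(ℝ, X.model) 𝓘(ℝ, Y.model) toFun (X.str.lift x) = Y.str.lift (toFun x)
  map_flip : ∀ v w,
    tangentMap 𝓘(ℝ, X.model) 𝓘(ℝ, Y.model) toFun (X.str.flip (v, w)) =
      Y.str.flip (toFun v, tangentMap 𝓘(ℝ, X.model) 𝓘(ℝ, Y.model) toFun w)

theorem tangentMap_comp_apply {X Y Z : SInvAlg.{u}} (f : Hom X Y) (g : Hom Y Z) (t : X.T) :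
    tangentMap 𝓘(ℝ, X.model) 𝓘(ℝ, Z.model) (g.toFun ∘ f.toFun) t =
      tangentMap 𝓘(ℝ, Y.model) 𝓘(ℝ, Z.model) g.toFun
        (tangentMap 𝓘(ℝ, X.model) 𝓘(ℝ, Y.model) f.toFun t) :=
  tangentMap_comp_at t (g.contMDiff_toFun.mdifferentiable (by simp) _)
    (f.contMDiff_toFun.mdifferentiable (by simp) _)

/-- The category of smooth involution algebras. -/
instance : Category SInvAlg.{u} where
  Hom := Hom
  id X :=
    { toFun := id
      contMDiff_toFun := contMDiff_id
      map_lift := fun x => by rw [tangentMap_id]; rfl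
      map_flip := fun v w => by rw [tangentMap_id]; rfl }
  comp f g :=
    { toFun := g.toFun ∘ f.toFun
      contMDiff_toFun := g.contMDiff_toFun.comp f.contMDiff_toFun
      map_lift := fun x => by
        rw [tangentMap_comp_apply, f.map_lift, g.map_lift]; rfl
      map_flip := fun v w => by
        rw [tangentMap_comp_apply, f.map_flip, g.map_flip, tangentMap_comp_apply]; rfl }

end SInvAlg

/-- A finite-dimensional real Lie algebra. -/
structure LieAlg where
  /-- the underlying set -/
  carrier : Type u
  [lieRing : LieRing carrier]
  [lieAlgebra : LieAlgebra ℝ carrier]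
  [finiteDimensional : FiniteDimensional ℝ carrier]

namespace LieAlg

attribute [instance] lieRing lieAlgebra finiteDimensional

/-- The category of finite-dimensional real Lie algebras. -/
instance : Category LieAlg.{u} where
  Hom A B := A.carrier →ₗ⁅ℝ⁆ B.carrier
  id A := LieHom.id
  comp f g := g.comp f

end LieAlg

/-! ### The involution algebra of a Lie algebra -/

namespace TangentStr

section

variable {V : Type u} [NormedAddCommGroup V] [NormedSpace ℝ V]

theorem exists_mk (w : TangentBundle 𝓘(ℝ, V) V) : ∃ a b : V, w = tmk 𝓘(ℝ, V) a b :=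
  ⟨_, _, rfl⟩

theorem extChartAt_tangent (p q : TangentBundle 𝓘(ℝ, V) V) :
    extChartAt 𝓘(ℝ, V).tangent p q = (q.1, vec q) := by
  simp only [mfld_simps, extChartAt]
  rfl

theorem extChartAt_tangent_symm (p : TangentBundle 𝓘(ℝ, V) V) (q : V × V) :
    (extChartAt 𝓘(ℝ, V).tangent p).symm q = tmk 𝓘(ℝ, V) q.1 q.2 := by
  simp only [mfld_simps, extChartAt]
  rfl

theorem contMDiff_mk {F H' N : Type u} [NormedAddCommGroup F] [NormedSpace ℝ F]
    [TopologicalSpace H'] {J : ModelWithCorners ℝ F H'} [TopologicalSpace N] [ChartedSpace H' N]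
    {f g : N → V} (hf : ContMDiff J 𝓘(ℝ, V) ∞ f) (hg : ContMDiff J 𝓘(ℝ, V) ∞ g) :
    ContMDiff J 𝓘(ℝ, V).tangent ∞ (fun x => tmk 𝓘(ℝ, V) (f x) (g x)) := by
  intro x
  rw [Bundle.contMDiffAt_totalSpace]
  refine ⟨hf x, ?_⟩
  simp only [trivializationAt_model_space_apply]
  exact hg x

theorem contMDiff_vec : ContMDiff 𝓘(ℝ, V).tangent 𝓘(ℝ, V) ∞
    (vec : TangentBundle 𝓘(ℝ, V) V → V) :=
  contMDiff_snd_tangentBundle_modelSpace V 𝓘(ℝ, V)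

theorem tangentMap_mk (f g : V → V) (x v : V) (L : V →L[ℝ] V × V)
    (hL : HasFDerivAt (fun y => (f y, g y)) L x) (hf : ContDiff ℝ ∞ f) (hg : ContDiff ℝ ∞ g) :
    tangentMap 𝓘(ℝ, V) 𝓘(ℝ, V).tangent (fun y : V => tmk 𝓘(ℝ, V) (f y) (g y))
      (tmk 𝓘(ℝ, V) x v) = tmk 𝓘(ℝ, V).tangent (tmk 𝓘(ℝ, V) (f x) (g x)) (L v) := by
  have : HasMFDerivAt 𝓘(ℝ, V) 𝓘(ℝ, V).tangent (fun y : V => tmk 𝓘(ℝ, V) (f y) (g y)) x L := by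
    refine ⟨(contMDiff_mk hf.contMDiff hg.contMDiff).continuous.continuousAt, ?_⟩
    have h1 : writtenInExtChartAt 𝓘(ℝ, V) 𝓘(ℝ, V).tangent x
        (fun y : V => tmk 𝓘(ℝ, V) (f y) (g y)) = fun y => (f y, g y) := by
      funext z
      simp only [writtenInExtChartAt, Function.comp, extChartAt_tangent]
      simp only [mfld_simps]
      rfl
    rw [h1]
    exact hL.hasFDerivWithinAt
  refine Bundle.TotalSpace.ext rfl (heq_of_eq ?_)
  exact congrArg (fun K : V →L[ℝ] V × V => K v) this.mfderiv

theorem tangentAdd_mk (x y v w : V) :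
    tangentAdd V V (tmk 𝓘(ℝ, V) x v) (tmk 𝓘(ℝ, V) y w) = tmk 𝓘(ℝ, V) (x + y) (v + w) := by
  have : HasMFDerivAt (𝓘(ℝ, V).prod 𝓘(ℝ, V)) 𝓘(ℝ, V) (fun q : V × V => q.1 + q.2) (x, y)
      (ContinuousLinearMap.fst ℝ V V + ContinuousLinearMap.snd ℝ V V) := by
    refine ⟨(continuous_fst.add continuous_snd).continuousAt, ?_⟩
    have h1 : writtenInExtChartAt (𝓘(ℝ, V).prod 𝓘(ℝ, V)) 𝓘(ℝ, V) (x, y)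
        (fun q : V × V => q.1 + q.2) = fun q => q.1 + q.2 := by
      funext z
      simp only [writtenInExtChartAt, Function.comp, extChartAt_prod, PartialEquiv.prod_symm,
        PartialEquiv.prod_coe]
      simp only [mfld_simps]
      rfl
    rw [h1]
    exact (hasFDerivAt_fst.add hasFDerivAt_snd).hasFDerivWithinAt
  refine Bundle.TotalSpace.ext rfl (heq_of_eq ?_)
  exact congrArg (fun K : V × V →L[ℝ] V => K (v, w)) this.mfderiv

theorem contMDiff_bilin (B : V →L[ℝ] V →L[ℝ] V) :
    ContMDiff (𝓘(ℝ, V).prod 𝓘(ℝ, V).tangent) 𝓘(ℝ, V).tangent ∞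
    (fun q : V × TangentBundle 𝓘(ℝ, V) V => tmk 𝓘(ℝ, V) q.1 (vec q.2 + B q.1 q.2.1)) := by
  have h1 : ContMDiff (𝓘(ℝ, V).prod 𝓘(ℝ, V).tangent) 𝓘(ℝ, V) ∞
      (fun q : V × TangentBundle 𝓘(ℝ, V) V => q.1) := contMDiff_fst
  have h2 : ContMDiff (𝓘(ℝ, V).prod 𝓘(ℝ, V).tangent) 𝓘(ℝ, V) ∞
      (fun q : V × TangentBundle 𝓘(ℝ, V) V => vec q.2) := contMDiff_vec.comp contMDiff_snd
  have h3 : ContMDiff (𝓘(ℝ, V).prod 𝓘(ℝ, V).tangent) 𝓘(ℝ, V) ∞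
      (fun q : V × TangentBundle 𝓘(ℝ, V) V => q.2.1) :=
    (Bundle.contMDiff_proj _).comp contMDiff_snd
  exact contMDiff_mk h1 (h2.add ((B.contMDiff.comp h1).clm_apply h3))

theorem tangentFlip_mk (α : V × TangentBundle 𝓘(ℝ, V) V → TangentBundle 𝓘(ℝ, V) V)
    (hc : Continuous α) (g : V × V × V → V × V)
    (hg : ∀ q, (α (q.1, tmk 𝓘(ℝ, V) q.2.1 q.2.2)).1 = (g q).1 ∧
      vec (α (q.1, tmk 𝓘(ℝ, V) q.2.1 q.2.2)) = (g q).2)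
    (x s : V) (y : TangentBundle 𝓘(ℝ, V) V) (t : V × V) (L : V × V × V →L[ℝ] V × V)
    (hL : HasFDerivAt g L (x, y.1, vec y)) :
    tangentFlip V V α (tmk 𝓘(ℝ, V) x s) (tmk 𝓘(ℝ, V).tangent y t) =
      tmk 𝓘(ℝ, V).tangent (α (x, y)) (L (s, t)) := by
  have : HasMFDerivAt (𝓘(ℝ, V).prod 𝓘(ℝ, V).tangent) 𝓘(ℝ, V).tangent α (x, y) L := by
    refine ⟨hc.continuousAt, ?_⟩
    have h1 : writtenInExtChartAt (𝓘(ℝ, V).prod 𝓘(ℝ, V).tangent) 𝓘(ℝ, V).tangent (x, y) α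
        = g := by
      funext z
      simp only [writtenInExtChartAt, Function.comp, extChartAt_tangent, extChartAt_prod,
        PartialEquiv.prod_symm, PartialEquiv.prod_coe, extChartAt_tangent_symm]
      exact Prod.ext (hg z).1 (hg z).2
    have h2 : extChartAt (𝓘(ℝ, V).prod 𝓘(ℝ, V).tangent) (x, y) (x, y) = (x, y.1, vec y) := by
      simp only [extChartAt_tangent, extChartAt_prod, PartialEquiv.prod_coe]
      simp only [mfld_simps]
      rfl
    rw [h1, h2]
    exact hL.hasFDerivWithinAt
  refine Bundle.TotalSpace.ext rfl (heq_of_eq ?_)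
  exact congrArg (fun K : V × V × V →L[ℝ] V × V => K (s, t)) this.mfderiv

theorem tangentFlip_bilin (B : V →L[ℝ] V →L[ℝ] V) (x s : V) (y : TangentBundle 𝓘(ℝ, V) V)
    (t : V × V) :
    tangentFlip V V (fun q => tmk 𝓘(ℝ, V) q.1 (vec q.2 + B q.1 q.2.1))
      (tmk 𝓘(ℝ, V) x s) (tmk 𝓘(ℝ, V).tangent y t) =
    tmk 𝓘(ℝ, V).tangent (tmk 𝓘(ℝ, V) x (vec y + B x y.1)) (s, t.2 + (B x t.1 + B s y.1)) := by
  have hB : HasFDerivAt (fun q : V × V => B q.1 q.2)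
      (B.isBoundedBilinearMap.deriv (x, y.1)) (x, y.1) :=
    B.isBoundedBilinearMap.hasFDerivAt (x, y.1)
  let L₂ : V × V × V →L[ℝ] V × V := (ContinuousLinearMap.fst ℝ V (V × V)).prod
    ((ContinuousLinearMap.fst ℝ V V).comp (ContinuousLinearMap.snd ℝ V (V × V)))
  let L₃ : V × V × V →L[ℝ] V :=
    (ContinuousLinearMap.snd ℝ V V).comp (ContinuousLinearMap.snd ℝ V (V × V))
  have h₂ : HasFDerivAt (fun q : V × V × V => (q.1, q.2.1)) L₂ (x, y.1, vec y) :=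
    L₂.hasFDerivAt
  have h₃ : HasFDerivAt (fun q : V × V × V => q.2.2) L₃ (x, y.1, vec y) := L₃.hasFDerivAt
  have h₄ : HasFDerivAt (fun q : V × V × V => B q.1 q.2.1)
      ((B.isBoundedBilinearMap.deriv (x, y.1)).comp L₂) (x, y.1, vec y) := by
    have := HasFDerivAt.comp (f := fun q : V × V × V => (q.1, q.2.1))
      (g := fun q : V × V => B q.1 q.2) (x, y.1, vec y) hB h₂
    exact this
  rw [tangentFlip_mk _ (contMDiff_bilin B).continuous
    (fun q => (q.1, q.2.2 + B q.1 q.2.1)) (fun q => ⟨rfl, rfl⟩) x s y t _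
    (hasFDerivAt_fst.prodMk (h₃.add h₄))]
  rfl

theorem tangentMap_clm {W : Type u} [NormedAddCommGroup W] [NormedSpace ℝ W] (f : V →L[ℝ] W)
    (t : TangentBundle 𝓘(ℝ, V) V) :
    tangentMap 𝓘(ℝ, V) 𝓘(ℝ, W) f t = tmk 𝓘(ℝ, W) (f t.1) (f (vec t)) := by
  refine Bundle.TotalSpace.ext rfl (heq_of_eq ?_)
  exact congrArg (fun K : V →L[ℝ] W => K (vec t)) f.hasMFDerivAt.mfderiv

theorem tangentMap_zero_section (x v : V) :
    tangentMap 𝓘(ℝ, V) 𝓘(ℝ, V).tangent (fun y : V => tmk 𝓘(ℝ, V) (0 : V) y) (tmk 𝓘(ℝ, V) x v) =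
      tmk 𝓘(ℝ, V).tangent (tmk 𝓘(ℝ, V) (0 : V) x) ((0 : V), v) :=
  tangentMap_mk (fun _ => 0) id x v ((0 : V →L[ℝ] V).prod (ContinuousLinearMap.id ℝ V))
    ((hasFDerivAt_const (0 : V) x).prodMk (hasFDerivAt_id x)) contDiff_const contDiff_id

end

end TangentStr

section

variable {V : Type u} [NormedAddCommGroup V] [NormedSpace ℝ V]

/-- The involution algebra of a Lie bracket `B` on a normed space `V`. -/
noncomputable def bilinStructure (B : V →L[ℝ] V →L[ℝ] V) (hB : ∀ x, B x x = 0)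
    (hJ : ∀ x y z, B x (B y z) = B (B x y) z + B y (B x z)) : InvolutionStructure V V where
  lift x := tmk 𝓘(ℝ, V) (0 : V) x
  contMDiff_lift := contMDiff_mk contMDiff_const contMDiff_id
  proj_lift _ := rfl
  lift_zero := rfl
  lift_add _ _ := rfl
  lift_add' a b := by rw [tangentAdd_mk, add_zero]
  lift_lift a := tangentMap_zero_section 0 a
  vert := vec
  contMDiff_vert := contMDiff_vec
  mu_vert t := (tangentAdd_mk t.1 0 0 (vec t)).trans (by rw [add_zero, zero_add]; rfl)
  vert_mu a b := (congrArg vec (tangentAdd_mk a 0 0 b)).trans (zero_add b)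
  flip q := tmk 𝓘(ℝ, V) q.1 (vec q.2 + B q.1 q.2.1)
  contMDiff_flip := contMDiff_bilin B
  proj_flip _ _ := rfl
  flip_linear v w := by
    obtain ⟨a, b, rfl⟩ := exists_mk w
    change tangentFlip V V _ (tmk 𝓘(ℝ, V) v 0)
      (cflip (tangentMap 𝓘(ℝ, V) 𝓘(ℝ, V).tangent _ (tmk 𝓘(ℝ, V) a b))) = _
    rw [tangentMap_zero_section]
    refine (tangentFlip_bilin B v 0 (tmk 𝓘(ℝ, V) 0 0) (a, b)).trans ?_
    have h₁ : (0 : V) + B v 0 = 0 := by simp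
    have h₂ : b + (B v a + B 0 0) = b + B v a := by simp
    exact congrArg₂ (fun r s : V => tmk 𝓘(ℝ, V).tangent (tmk 𝓘(ℝ, V) v r) ((0 : V), s)) h₁ h₂
  flip_linear' v w := by
    obtain ⟨a, b, rfl⟩ := exists_mk w
    change _ = cflip (tangentMap 𝓘(ℝ, V) 𝓘(ℝ, V).tangent _ (tmk 𝓘(ℝ, V) v (b + B v a)))
    rw [tangentMap_zero_section]
    refine (tangentFlip_bilin B 0 v (tmk 𝓘(ℝ, V) a 0) (0, b)).trans ?_
    have h₁ : (0 : V) + B 0 a = 0 := by simp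
    have h₂ : b + (B 0 0 + B v a) = b + B v a := by simp
    exact congrArg₂ (fun r s : V => tmk 𝓘(ℝ, V).tangent (tmk 𝓘(ℝ, V) 0 r) (v, s)) h₁ h₂
  flip_unit v := by
    have h : v + B 0 0 = v := by simp
    exact congrArg (tmk 𝓘(ℝ, V) (0 : V)) h
  flip_inv v w := by
    obtain ⟨a, b, rfl⟩ := exists_mk w
    have h := hB (v + a)
    simp only [map_add, _root_.add_apply, hB, zero_add, add_zero] at h
    have h' : b + B v a + B a v = b := by rw [add_assoc, add_comm (B v a), h, add_zero]
    exact congrArg (tmk 𝓘(ℝ, V) a) h'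
  flip_flip v w x := by
    obtain ⟨a, b, rfl⟩ := exists_mk w
    obtain ⟨y, t, rfl⟩ : ∃ y t, x = tmk 𝓘(ℝ, V).tangent y t := ⟨_, _, rfl⟩
    obtain ⟨c, d, rfl⟩ := exists_mk y
    obtain ⟨e, f⟩ := t
    refine (tangentFlip_bilin B v (b + B v a) (tmk 𝓘(ℝ, V) c d) (e, f)).trans ?_
    have h₁ := tangentFlip_bilin B a b (tmk 𝓘(ℝ, V) c e) (d, f)
    have h₂ := tangentFlip_bilin B v (d + B v c) (tmk 𝓘(ℝ, V) a b)
      (e + B a c, f + (B a d + B b c))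
    have hs : ∀ p q, B p q = - B q p := fun p q => by
      have h := hB (p + q)
      simp only [map_add, _root_.add_apply, hB, zero_add, add_zero] at h
      exact eq_neg_of_add_eq_zero_left (by rw [add_comm]; exact h)
    have h₃ : f + (B v e + B (b + B v a) c) =
        f + (B a d + B b c) + (B v (e + B a c) + B (d + B v c) a) := by
      simp only [map_add, _root_.add_apply]
      rw [hJ v a c, hs d a, hs (B v c) a]
      abel
    refine Eq.trans ?_ (congrArg cflip (((congrArg (tangentFlip V V
      (fun q => tmk 𝓘(ℝ, V) q.1 (vec q.2 + B q.1 q.2.1)) (tmk 𝓘(ℝ, V) v (d + B v c)))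
        (congrArg cflip h₁)).trans h₂))).symm
    exact congrArg (fun r : V => tmk 𝓘(ℝ, V).tangent (tmk 𝓘(ℝ, V) v (d + B v c)) (b + B v a, r)) h₃

end

namespace LieAlg

variable (A : LieAlg.{u})

/-- The bracket as a bilinear map. -/
def bracketLM : A.carrier →ₗ[ℝ] A.carrier →ₗ[ℝ] A.carrier :=
  LinearMap.mk₂ ℝ (fun x y => ⁅x, y⁆) add_lie smul_lie lie_add (fun c x y => lie_smul c x y)

/-- A norm on a finite-dimensional Lie algebra, coming from a basis. It induces the canonical
topology and smooth structure of the underlying vector space. -/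
@[reducible]
noncomputable def normedAddCommGroup : NormedAddCommGroup A.carrier :=
  NormedAddCommGroup.induced A.carrier (Fin (Module.finrank ℝ A.carrier) → ℝ)
    (Module.finBasis ℝ A.carrier).equivFun (Module.finBasis ℝ A.carrier).equivFun.injective

attribute [local instance] normedAddCommGroup

/-- The normed space given by a basis of a finite-dimensional Lie algebra. -/
@[reducible]
noncomputable def normedSpace : NormedSpace ℝ A.carrier where
  norm_smul_le a b := norm_smul_le a ((Module.finBasis ℝ A.carrier).equivFun b)|>.trans' (by
    change ‖(Module.finBasis ℝ A.carrier).equivFun (a • b)‖ ≤ _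
    rw [map_smul])

attribute [local instance] normedSpace

/-- The bracket as a continuous bilinear map. -/
noncomputable def bracketCLM : A.carrier →L[ℝ] A.carrier →L[ℝ] A.carrier :=
  A.bracketLM.toContinuousBilinearMap

theorem bracketCLM_apply (x y : A.carrier) : A.bracketCLM x y = ⁅x, y⁆ := rfl

/-- The involution algebra of a Lie algebra: the flip is `α(v, w_H, w_V) = (v, w_V + [v, w_H])`. -/
noncomputable def toSInvAlg : SInvAlg.{u} where
  carrier := A.carrier
  model := A.carrier
  secondCountable := 
    haveI := FiniteDimensional.proper ℝ A.carrier
    secondCountable_of_proper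
  str := bilinStructure A.bracketCLM (fun x => lie_self x) (fun x y z => leibniz_lie x y z)

variable {A} in
/-- A morphism of Lie algebras as a continuous linear map. -/
noncomputable def homCLM {B : LieAlg.{u}} (f : A.carrier →ₗ⁅ℝ⁆ B.carrier) :
    A.carrier →L[ℝ] B.carrier :=
  LinearMap.toContinuousLinearMap (f : A.carrier →ₗ[ℝ] B.carrier)

/-- The functor `ι` from Lie algebras to smooth involution algebras, the identity on arrows. -/
noncomputable def toInvolution : LieAlg.{u} ⥤ SInvAlg.{u} where
  obj A := A.toSInvAlg
  map {A B} f :=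
    { toFun := homCLM f
      contMDiff_toFun := (homCLM f).contMDiff
      map_lift := fun x =>
        (tangentMap_clm (homCLM f) (tmk 𝓘(ℝ, A.carrier) (0 : A.carrier) x)).trans
          (congrArg (fun y => tmk 𝓘(ℝ, B.carrier) y (homCLM f x)) (map_zero (homCLM f)))
      map_flip := fun v w => by
        obtain ⟨a, b, rfl⟩ : ∃ a b : A.carrier, w = tmk 𝓘(ℝ, A.carrier) a b := ⟨_, _, rfl⟩
        have h : homCLM f (b + A.bracketCLM v a) = homCLM f b + B.bracketCLM (homCLM f v) (homCLM f a) :=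
          (map_add (homCLM f) b _).trans
            (congrArg (homCLM f b + ·) (LieHom.map_lie (show A.carrier →ₗ⁅ℝ⁆ B.carrier from f) v a))
        refine (tangentMap_clm (homCLM f) (tmk 𝓘(ℝ, A.carrier) v (b + A.bracketCLM v a))).trans
          ((congrArg (tmk 𝓘(ℝ, B.carrier) (homCLM f v)) h).trans ?_)
        exact congrArg (fun t => B.toSInvAlg.str.flip (homCLM f v, t))
          (tangentMap_clm (homCLM f) (tmk 𝓘(ℝ, A.carrier) a b)).symm }

end LieAlg

/-! ### The Lie bracket of an involution algebra -/

namespace SInvAlg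

variable (X : SInvAlg.{u})

/-- The bracket `[x, y] = π₁α(x, y, 0)`, under the isomorphism `μ : A × A → TA`. -/
noncomputable def bracket (x y : X.carrier) : X.carrier :=
  X.str.vert (X.str.flip (x, X.str.mu y 0))

variable {X}

theorem tangentAdd_zero_left (t : X.T) :
    tangentAdd X.model X.carrier (TangentStr.zero 𝓘(ℝ, X.model) 0) t = t := by
  have h₁ : MDifferentiableAt (𝓘(ℝ, X.model).prod 𝓘(ℝ, X.model)) 𝓘(ℝ, X.model)
      (fun q : X.carrier × X.carrier => q.1 + q.2) (0, t.proj) :=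
    (contMDiff_add 𝓘(ℝ, X.model) ∞).mdifferentiable (by simp) _
  have h₂ : MDifferentiableAt 𝓘(ℝ, X.model) (𝓘(ℝ, X.model).prod 𝓘(ℝ, X.model))
      (fun x : X.carrier => ((0 : X.carrier), x)) t.proj :=
    (contMDiff_const.prodMk contMDiff_id : ContMDiff _ _ ∞ _).mdifferentiable (by simp) _
  have h := tangentMap_comp_at t h₁ h₂
  rw [tangentMap_prod_right] at h
  refine h.symm.trans ?_
  have h₃ : (fun q : X.carrier × X.carrier => q.1 + q.2) ∘
      (fun x : X.carrier => ((0 : X.carrier), x)) = id := funext fun x => zero_add x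
  rw [h₃, tangentMap_id]
  rfl

theorem vert_lift (x : X.carrier) : X.str.vert (X.str.lift x) = x := by
  have h := X.str.vert_mu 0 x
  rwa [tangentAdd_zero_left] at h

theorem lift_vert (t : X.T) (ht : t.proj = 0) : X.str.lift (X.str.vert t) = t := by
  have h := X.str.mu_vert t
  rwa [ht, tangentAdd_zero_left] at h

/-- The scalar multiplication for which the lift is linear: `λ(r x) = r λ(x)`. -/
noncomputable instance : SMul ℝ X.carrier :=
  ⟨fun r x => X.str.vert (TangentStr.smul r (X.str.lift x))⟩

theorem lift_smul (r : ℝ) (x : X.carrier) :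
    X.str.lift (r • x) = TangentStr.smul r (X.str.lift x) :=
  lift_vert _ (X.str.proj_lift x)

/-- The coordinates of the lift. -/
noncomputable def coord (x : X.carrier) : X.model := vec (X.str.lift x)

theorem lift_eq (x : X.carrier) : X.str.lift x = tmk 𝓘(ℝ, X.model) 0 (coord x) := by
  have : ∀ t : X.T, t.proj = 0 → t = tmk 𝓘(ℝ, X.model) 0 (vec t) := by
    rintro ⟨a, b⟩ h
    cases h
    rfl
  exact this _ (X.str.proj_lift x)

theorem coord_injective : Function.Injective (coord : X.carrier → X.model) := fun x y h => by
  rw [← vert_lift x, ← vert_lift y, lift_eq, lift_eq, h]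

theorem coord_add (x y : X.carrier) : coord (x + y) = coord x + coord y :=
  congrArg vec (X.str.lift_add x y)

theorem coord_smul (r : ℝ) (x : X.carrier) : coord (r • x) = r • coord x :=
  congrArg vec (lift_smul r x)

/-- The vector space structure of an involution algebra. -/
noncomputable instance : Module ℝ X.carrier where
  one_smul x := coord_injective (by rw [coord_smul, one_smul])
  mul_smul r s x := coord_injective (by simp only [coord_smul, mul_smul])
  smul_zero r := coord_injective (by
    have h : coord (0 : X.carrier) = 0 := congrArg vec X.str.lift_zero
    rw [coord_smul, h, smul_zero])
  smul_add r x y := coord_injective (by simp only [coord_smul, coord_add, smul_add])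
  add_smul r s x := coord_injective (by simp only [coord_smul, coord_add, add_smul])
  zero_smul x := coord_injective (by
    have h : coord (0 : X.carrier) = 0 := congrArg vec X.str.lift_zero
    rw [coord_smul, h, zero_smul])

instance finiteDimensional_carrier : FiniteDimensional ℝ X.carrier :=
  Module.Finite.of_injective
    ({ toFun := coord, map_add' := coord_add, map_smul' := coord_smul } :
      X.carrier →ₗ[ℝ] X.model) coord_injective

variable (X) in
/-- The assertion that `SInvAlg.bracket` is a Lie bracket. -/
structure BracketIsLie : Prop where
  add_left : ∀ x y z, X.bracket (x + y) z = X.bracket x z + X.bracket y z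
  add_right : ∀ x y z, X.bracket x (y + z) = X.bracket x y + X.bracket x z
  smul_left : ∀ (r : ℝ) x y, X.bracket (r • x) y = r • X.bracket x y
  smul_right : ∀ (r : ℝ) x y, X.bracket x (r • y) = r • X.bracket x y
  antisymm : ∀ x y, X.bracket x y = - X.bracket y x
  jacobi : ∀ x y z,
    X.bracket (X.bracket x y) z = X.bracket (X.bracket x z) y + X.bracket x (X.bracket y z)

/-- The Lie ring structure of an involution algebra, once `SInvAlg.bracket` is known to be a Lie
bracket. -/
@[reducible]
noncomputable def toLieRing (h : X.BracketIsLie) : LieRing X.carrier where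
  bracket := X.bracket
  add_lie := h.add_left
  lie_add := h.add_right
  lie_self x := by
    have h₁ : (2 : ℝ) • X.bracket x x = 0 := by
      rw [two_smul]
      nth_rewrite 1 [h.antisymm x x]
      exact neg_add_cancel _
    exact (smul_eq_zero.1 h₁).resolve_left two_ne_zero
  leibniz_lie x y z := by
    change X.bracket x (X.bracket y z) =
      X.bracket (X.bracket x y) z + X.bracket y (X.bracket x z)
    rw [h.jacobi x y z, h.antisymm y (X.bracket x z)]
    abel

/-- The Lie algebra structure of an involution algebra, once `SInvAlg.bracket` is known to be a
Lie bracket. -/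
@[reducible]
noncomputable def toLieAlgebra (h : X.BracketIsLie) :
    @LieAlgebra ℝ X.carrier _ (toLieRing h) :=
  letI := toLieRing h
  { lie_smul := fun r x y => h.smul_right r x y }

/-- The Lie algebra of an involution algebra, once `SInvAlg.bracket` is known to be a Lie
bracket. -/
noncomputable def toLieAlg (h : X.BracketIsLie) : LieAlg.{u} :=
  letI := toLieRing h
  letI := toLieAlgebra h
  ⟨X.carrier⟩

theorem exists_coord_map {Y : SInvAlg.{u}} (f : X ⟶ Y) :
    ∃ D : X.model →L[ℝ] Y.model, ∀ x, coord (f.toFun x) = D (coord x) := by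
  refine ⟨mfderiv 𝓘(ℝ, X.model) 𝓘(ℝ, Y.model) f.toFun (0 : X.carrier), fun x => ?_⟩
  have h := f.map_lift x
  rw [lift_eq x] at h
  exact (congrArg vec h).symm

theorem map_add_hom {Y : SInvAlg.{u}} (f : X ⟶ Y) (x y : X.carrier) :
    f.toFun (x + y) = f.toFun x + f.toFun y := by
  obtain ⟨D, hD⟩ := exists_coord_map f
  exact coord_injective (by rw [coord_add, hD, hD, hD, coord_add, map_add])

theorem map_smul_hom {Y : SInvAlg.{u}} (f : X ⟶ Y) (r : ℝ) (x : X.carrier) :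
    f.toFun (r • x) = r • f.toFun x := by
  obtain ⟨D, hD⟩ := exists_coord_map f
  exact coord_injective (by rw [coord_smul, hD, hD, coord_smul, map_smul])

theorem tangentMap_tangentAdd {Y : SInvAlg.{u}} (f : X ⟶ Y) (s t : X.T) :
    tangentMap 𝓘(ℝ, X.model) 𝓘(ℝ, Y.model) f.toFun (tangentAdd X.model X.carrier s t) =
      tangentAdd Y.model Y.carrier (tangentMap 𝓘(ℝ, X.model) 𝓘(ℝ, Y.model) f.toFun s)
        (tangentMap 𝓘(ℝ, X.model) 𝓘(ℝ, Y.model) f.toFun t) := by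
  have hf : MDifferentiable 𝓘(ℝ, X.model) 𝓘(ℝ, Y.model) f.toFun :=
    f.contMDiff_toFun.mdifferentiable (by simp)
  have hX : MDifferentiable (𝓘(ℝ, X.model).prod 𝓘(ℝ, X.model)) 𝓘(ℝ, X.model)
      (fun q : X.carrier × X.carrier => q.1 + q.2) :=
    (contMDiff_add 𝓘(ℝ, X.model) ∞).mdifferentiable (by simp)
  have hY : MDifferentiable (𝓘(ℝ, Y.model).prod 𝓘(ℝ, Y.model)) 𝓘(ℝ, Y.model)
      (fun q : Y.carrier × Y.carrier => q.1 + q.2) :=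
    (contMDiff_add 𝓘(ℝ, Y.model) ∞).mdifferentiable (by simp)
  let p := (equivTangentBundleProd 𝓘(ℝ, X.model) X.carrier 𝓘(ℝ, X.model) X.carrier).symm (s, t)
  have h₁ := tangentMap_comp_at p (hf _) (hX _)
  have h₂ := tangentMap_comp_at p (hY _) ((hf.prodMap hf) _)
  have h₃ : f.toFun ∘ (fun q : X.carrier × X.carrier => q.1 + q.2) =
      (fun q : Y.carrier × Y.carrier => q.1 + q.2) ∘ Prod.map f.toFun f.toFun :=
    funext fun q => map_add_hom f q.1 q.2
  refine h₁.symm.trans ((congrArg (fun g => tangentMap _ _ g p) h₃).trans (h₂.trans ?_))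
  refine congrArg (tangentMap _ _ _) (Bundle.TotalSpace.ext rfl (heq_of_eq ?_))
  exact congrArg (fun D : X.model × X.model →L[ℝ] Y.model × Y.model => D p.2)
    (mfderiv_prodMap (hf s.1) (hf t.1))

theorem map_mu {Y : SInvAlg.{u}} (f : X ⟶ Y) (x y : X.carrier) :
    tangentMap 𝓘(ℝ, X.model) 𝓘(ℝ, Y.model) f.toFun (X.str.mu x y) =
      Y.str.mu (f.toFun x) (f.toFun y) := by
  have h : tangentMap 𝓘(ℝ, X.model) 𝓘(ℝ, Y.model) f.toFun (TangentStr.zero 𝓘(ℝ, X.model) x)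
      = TangentStr.zero 𝓘(ℝ, Y.model) (f.toFun x) :=
    Bundle.TotalSpace.ext rfl (heq_of_eq (map_zero (mfderiv _ _ f.toFun x)))
  rw [DifferentialObject.mu, tangentMap_tangentAdd, h, f.map_lift]
  rfl

theorem map_vert {Y : SInvAlg.{u}} (f : X ⟶ Y) (t : X.T) :
    f.toFun (X.str.vert t) =
      Y.str.vert (tangentMap 𝓘(ℝ, X.model) 𝓘(ℝ, Y.model) f.toFun t) := by
  have h := map_mu f t.proj (X.str.vert t)
  have h' : X.str.mu t.proj (X.str.vert t) = t := X.str.mu_vert t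
  rw [h'] at h
  rw [h]
  exact (Y.str.vert_mu _ _).symm

theorem map_zero_hom {Y : SInvAlg.{u}} (f : X ⟶ Y) : f.toFun 0 = 0 := by
  have h := map_add_hom f 0 0
  rw [add_zero] at h
  exact left_eq_add.1 h

theorem map_bracket {Y : SInvAlg.{u}} (f : X ⟶ Y) (x y : X.carrier) :
    f.toFun (X.bracket x y) = Y.bracket (f.toFun x) (f.toFun y) := by
  rw [bracket, bracket, map_vert, f.map_flip, map_mu, map_zero_hom]

/-- The functor from smooth involution algebras to Lie algebras, the identity on arrows, once the
brackets `[x, y] = π₁α(x, y, 0)` are known to be Lie brackets. -/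
noncomputable def toLie (h : ∀ X : SInvAlg.{u}, X.BracketIsLie) : SInvAlg.{u} ⥤ LieAlg.{u} where
  obj X := toLieAlg (h X)
  map {X Y} f :=
    letI := toLieRing (h X)
    letI := toLieAlgebra (h X)
    letI := toLieRing (h Y)
    letI := toLieAlgebra (h Y)
    (show X.carrier →ₗ⁅ℝ⁆ Y.carrier from
    { toFun := f.toFun
      map_add' := map_add_hom f
      map_smul' := map_smul_hom f
      map_lie' := fun {x y} => map_bracket f x y })

end SInvAlg

/-!
The equivalence rests on the fact that a smooth involution algebra `X` is, up to isomorphism, a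
vector space with the flip `α(v, (h, k)) = (v, k + B(v, h))` of a Lie bracket `B`.

*Reduction to a vector space.* The lift takes values in the tangent space at `0`, so it is given by
coordinates `coord : X → E` in the model space. They are additive, smooth, and invertible with
smooth inverse because `μ` is a diffeomorphism, and `T(λ)λ = lλ` says that their derivative at `0`
is the identity (`SInvAlg.tangentMap_coord_lift`). Hence they carry the lift of `X` to the standard
lift `e ↦ (0, e)` of `E`, and the flip can be transported along them
(`SInvAlg.coordStructure`). The axioms survive the transport because the vertical lift and the
canonical flip are natural; for the latter this is the symmetry of second derivatives
(`TangentStr.tangentMap_cflip`).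

*Shape of the flip.* Over `E` write `α(v, (h, k)) = (v, G(v, h, k))`. The two linearity axioms say
that `G(v, -, -)` and `G(-, h, -)` coincide with their derivatives at `0`, so they are linear, and
with the unit axiom `G(v, h, k) = k + B(v, h)` for a bilinear map `B`. The involution axiom is the
antisymmetry of `B`, and the Yang–Baxter axiom for `T(α)`, on suitable vectors, is the Jacobi
identity (`InvolutionStructure.exists_bracket`).

*Conclusion.* In coordinates `B` is the bracket `[x, y] = π₁α(x, y, 0)`, so the flip is determined by
the bracket, and every linear map that preserves brackets is a morphism of involution algebras
(`SInvAlg.homOfLinear`). Applied to the identity map, this gives the natural isomorphism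
`ι(r(X)) → X`, while `r(ι(A)) = A` is a direct computation.
-/

/-! ### Naturality of the tangent structure -/

namespace TangentStr

section

universe v w

variable {E : Type u} [NormedAddCommGroup E] [NormedSpace ℝ E]
  {A : Type v} [TopologicalSpace A] [ChartedSpace E A]
  {W : Type w} [NormedAddCommGroup W] [NormedSpace ℝ W]

/-- The local representative of a map into a vector space, in the preferred chart at `x`. -/
noncomputable def localRep (φ : A → W) (x : A) : E → W := φ ∘ (chartAt E x).symm

theorem writtenInExtChartAt_eq_localRep (φ : A → W) (x : A) :
    writtenInExtChartAt 𝓘(ℝ, E) 𝓘(ℝ, W) x φ = localRep φ x := by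
  funext y
  simp only [writtenInExtChartAt, localRep, mfld_simps]
  rfl

theorem tangentMap_zero {φ : A → W} (x : A) :
    tangentMap 𝓘(ℝ, E) 𝓘(ℝ, W) φ (TangentStr.zero 𝓘(ℝ, E) x) = TangentStr.zero 𝓘(ℝ, W) (φ x) :=
  Bundle.TotalSpace.ext rfl (heq_of_eq (map_zero (mfderiv _ _ φ x)))

variable [IsManifold 𝓘(ℝ, E) ∞ A]

/-- The preferred chart of `TA` at a tangent vector at `x` gives the fibre over `x` its coordinates
in the preferred chart at `x`. -/
theorem extChartAt_tmk (x : A) (v w : E) :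
    extChartAt 𝓘(ℝ, E).tangent (tmk 𝓘(ℝ, E) x v) (tmk 𝓘(ℝ, E) x w) = (chartAt E x x, w) :=
  Prod.ext rfl
    ((tangentBundleCore 𝓘(ℝ, E) A).coordChange_self (achart E x) x (mem_achart_source E x) w)

theorem trivializationAt_tmk (x : A) (v : E) :
    trivializationAt E (TangentSpace 𝓘(ℝ, E)) x (tmk 𝓘(ℝ, E) x v) = (x, v) :=
  Prod.ext rfl
    ((tangentBundleCore 𝓘(ℝ, E) A).coordChange_self (achart E x) x (mem_achart_source E x) v)

theorem contDiffAt_localRep {φ : A → W} (hφ : ContMDiff 𝓘(ℝ, E) 𝓘(ℝ, W) ∞ φ) {x : A} {y : E}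
    (hy : y ∈ (chartAt E x).target) : ContDiffAt ℝ ∞ (localRep φ x) y := by
  have h : ContMDiffAt 𝓘(ℝ, E) 𝓘(ℝ, E) ∞ (chartAt E x).symm y :=
    (contMDiffOn_chart_symm (I := 𝓘(ℝ, E)) (n := ∞) (x := x)).contMDiffAt
      ((chartAt E x).open_target.mem_nhds hy)
  exact ((hφ _).comp y h).contDiffAt

theorem hasMFDerivAt_localRep {φ : A → W} (hφ : ContMDiff 𝓘(ℝ, E) 𝓘(ℝ, W) ∞ φ) (x : A) :
    HasMFDerivAt 𝓘(ℝ, E) 𝓘(ℝ, W) φ x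
      (fderiv ℝ (E := E) (F := W) (localRep φ x) (chartAt E x x)) := by
  refine ⟨hφ.continuous.continuousAt, ?_⟩
  rw [writtenInExtChartAt_eq_localRep]
  exact ((contDiffAt_localRep hφ (mem_chart_target E x)).differentiableAt
    (by simp)).hasFDerivAt.hasFDerivWithinAt

theorem tangentMap_tmk {φ : A → W} (hφ : ContMDiff 𝓘(ℝ, E) 𝓘(ℝ, W) ∞ φ) (x : A) (v : E) :
    tangentMap 𝓘(ℝ, E) 𝓘(ℝ, W) φ (tmk 𝓘(ℝ, E) x v) =
      tmk 𝓘(ℝ, W) (φ x) (fderiv ℝ (localRep φ x) (chartAt E x x) v) := by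
  refine Bundle.TotalSpace.ext rfl (heq_of_eq ?_)
  exact congrArg (fun K : E →L[ℝ] W => K v) (hasMFDerivAt_localRep hφ x).mfderiv

/-- On the chart of `TA` induced by the preferred chart at `x`, a tangent map `T(φ)` is
`(y, v) ↦ (φ y, dφ_y v)`. -/
theorem tangentMap_chart_symm_tmk {φ : A → W} (hφ : ContMDiff 𝓘(ℝ, E) 𝓘(ℝ, W) ∞ φ)
    (t : TangentBundle 𝓘(ℝ, E) A) {q : E × E} (hq : q.1 ∈ (chartAt E t.1).target) :
    tangentMap 𝓘(ℝ, E) 𝓘(ℝ, W) φ ((chartAt (ModelProd E E) t).symm q) =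
      tmk 𝓘(ℝ, W) (localRep φ t.1 q.1) (fderiv ℝ (localRep φ t.1) q.1 q.2) := by
  have h₁ := tangentMap_chart_symm (I := 𝓘(ℝ, E)) (p := t) (q := tmk 𝓘(ℝ, E) q.1 q.2) hq
  have h₂ := tangentMap_comp_at (tmk 𝓘(ℝ, E) q.1 q.2)
    (hφ.mdifferentiable (by simp) ((chartAt E t.1).symm q.1))
    (mdifferentiableAt_atlas_symm (I := 𝓘(ℝ, E)) (chart_mem_atlas E t.1) hq)
  refine (congrArg _ h₁.symm).trans (h₂.symm.trans ?_)
  refine Bundle.TotalSpace.ext rfl (heq_of_eq ?_)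
  exact congrArg (fun K : E →L[ℝ] W => K q.2) (mfderiv_eq_fderiv (f := localRep φ t.1) (x := q.1))

/-- The second tangent map in coordinates:
`(x, v; w₁, w₂) ↦ (φ x, dφ v; dφ w₁, d²φ(w₁, v) + dφ w₂)`. -/
theorem tangentMap_tangentMap_tmk {φ : A → W} (hφ : ContMDiff 𝓘(ℝ, E) 𝓘(ℝ, W) ∞ φ) (x : A)
    (v w₁ w₂ : E) :
    tangentMap 𝓘(ℝ, E).tangent 𝓘(ℝ, W).tangent (tangentMap 𝓘(ℝ, E) 𝓘(ℝ, W) φ)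
      (tmk 𝓘(ℝ, E).tangent (tmk 𝓘(ℝ, E) x v) (w₁, w₂)) =
    tmk 𝓘(ℝ, W).tangent
      (tmk 𝓘(ℝ, W) (φ x) (fderiv ℝ (localRep φ x) (chartAt E x x) v))
      (fderiv ℝ (localRep φ x) (chartAt E x x) w₁,
        fderiv ℝ (fderiv ℝ (localRep φ x)) (chartAt E x x) w₁ v +
          fderiv ℝ (localRep φ x) (chartAt E x x) w₂) := by
  set g : E → W := localRep φ x
  set x' := chartAt E x x
  have hgx : ContDiffAt ℝ ∞ g x' := contDiffAt_localRep hφ (mem_chart_target E x)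
  have h₁ : HasFDerivAt g (fderiv ℝ g x') x' := (hgx.differentiableAt (by simp)).hasFDerivAt
  have h₂ : HasFDerivAt (fderiv ℝ g) (fderiv ℝ (fderiv ℝ g) x') x' :=
    ((hgx.fderiv_right (m := ∞) (mod_cast le_rfl)).differentiableAt (by simp)).hasFDerivAt
  let fstE := ContinuousLinearMap.fst ℝ E E
  let sndE := ContinuousLinearMap.snd ℝ E E
  have h₃ : HasFDerivAt (fun q : E × E => fderiv ℝ g q.1)
      ((fderiv ℝ (fderiv ℝ g) x').comp fstE) (x', v) :=
    HasFDerivAt.comp (f := fun q : E × E => q.1) (x', v) h₂ hasFDerivAt_fst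
  have h₄ : HasFDerivAt (fun q : E × E => g q.1) ((fderiv ℝ g x').comp fstE) (x', v) :=
    HasFDerivAt.comp (f := fun q : E × E => q.1) (x', v) h₁ hasFDerivAt_fst
  let L : E × E →L[ℝ] W × W := ((fderiv ℝ g x').comp fstE).prod
    ((fderiv ℝ g x').comp sndE + ((fderiv ℝ (fderiv ℝ g) x').comp fstE).flip v)
  have h₅ : HasFDerivAt (fun q : E × E => (g q.1, fderiv ℝ g q.1 q.2)) L (x', v) :=
    h₄.prodMk (h₃.clm_apply (hasFDerivAt_snd (p := (x', v))))
  have h₆ : HasMFDerivAt 𝓘(ℝ, E).tangent 𝓘(ℝ, W).tangent (tangentMap 𝓘(ℝ, E) 𝓘(ℝ, W) φ)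
      (tmk 𝓘(ℝ, E) x v) L := by
    refine ⟨(hφ.continuous_tangentMap (by simp)).continuousAt, ?_⟩
    have hev : writtenInExtChartAt 𝓘(ℝ, E).tangent 𝓘(ℝ, W).tangent (tmk 𝓘(ℝ, E) x v)
        (tangentMap 𝓘(ℝ, E) 𝓘(ℝ, W) φ) =ᶠ[nhds (x', v)]
          fun q : E × E => (g q.1, fderiv ℝ g q.1 q.2) := by
      have hnhds : {q : E × E | q.1 ∈ (chartAt E x).target} ∈ nhds (x', v) :=
        ((chartAt E x).open_target.preimage continuous_fst).mem_nhds (mem_chart_target E x)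
      filter_upwards [hnhds] with q hq
      simp only [writtenInExtChartAt, Function.comp, extChartAt_tangent]
      have := tangentMap_chart_symm_tmk hφ (tmk 𝓘(ℝ, E) x v) (q := q) hq
      exact congrArg (fun t : TangentBundle 𝓘(ℝ, W) W => (t.1, vec t)) this
    rw [extChartAt_tmk]
    exact (h₅.congr_of_eventuallyEq hev).hasFDerivWithinAt
  have h₇ : tangentMap 𝓘(ℝ, E).tangent 𝓘(ℝ, W).tangent (tangentMap 𝓘(ℝ, E) 𝓘(ℝ, W) φ)
      (tmk 𝓘(ℝ, E).tangent (tmk 𝓘(ℝ, E) x v) (w₁, w₂)) = tmk 𝓘(ℝ, W).tangent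
        (tangentMap 𝓘(ℝ, E) 𝓘(ℝ, W) φ (tmk 𝓘(ℝ, E) x v)) (L (w₁, w₂)) :=
    Bundle.TotalSpace.ext rfl (heq_of_eq
      (congrArg (fun K : E × E →L[ℝ] W × W => K (w₁, w₂)) h₆.mfderiv))
  rw [h₇]
  exact congrArg₂ (tmk 𝓘(ℝ, W).tangent) (tangentMap_tmk hφ x v) (Prod.ext rfl (add_comm _ _))

theorem exists_tmk_tmk (t : TangentBundle 𝓘(ℝ, E).tangent (TangentBundle 𝓘(ℝ, E) A)) :
    ∃ (x : A) (v w₁ w₂ : E), t = tmk 𝓘(ℝ, E).tangent (tmk 𝓘(ℝ, E) x v) (w₁, w₂) :=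
  ⟨_, _, _, _, rfl⟩

theorem tangentMap_vlift {φ : A → W} (hφ : ContMDiff 𝓘(ℝ, E) 𝓘(ℝ, W) ∞ φ)
    (t : TangentBundle 𝓘(ℝ, E) A) :
    tangentMap 𝓘(ℝ, E).tangent 𝓘(ℝ, W).tangent (tangentMap 𝓘(ℝ, E) 𝓘(ℝ, W) φ) (vlift t) =
      vlift (tangentMap 𝓘(ℝ, E) 𝓘(ℝ, W) φ t) := by
  refine (tangentMap_tangentMap_tmk hφ t.1 0 0 (vec t)).trans ?_
  rw [show tangentMap 𝓘(ℝ, E) 𝓘(ℝ, W) φ t = _ from tangentMap_tmk hφ t.1 (vec t)]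
  simp only [map_zero, zero_add]
  rfl

/-- The canonical flip is natural because second derivatives are symmetric. -/
theorem tangentMap_cflip {φ : A → W} (hφ : ContMDiff 𝓘(ℝ, E) 𝓘(ℝ, W) ∞ φ)
    (t : TangentBundle 𝓘(ℝ, E).tangent (TangentBundle 𝓘(ℝ, E) A)) :
    tangentMap 𝓘(ℝ, E).tangent 𝓘(ℝ, W).tangent (tangentMap 𝓘(ℝ, E) 𝓘(ℝ, W) φ) (cflip t) =
      cflip (tangentMap 𝓘(ℝ, E).tangent 𝓘(ℝ, W).tangent (tangentMap 𝓘(ℝ, E) 𝓘(ℝ, W) φ) t) := by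
  obtain ⟨x, v, w₁, w₂, rfl⟩ := exists_tmk_tmk t
  have hs : IsSymmSndFDerivAt ℝ (localRep φ x) (chartAt E x x) :=
    (contDiffAt_localRep hφ (mem_chart_target E x)).isSymmSndFDerivAt
      (by rw [minSmoothness_of_isRCLikeNormedField]; exact WithTop.coe_le_coe.2 le_top)
  rw [tangentMap_tangentMap_tmk hφ]
  refine (tangentMap_tangentMap_tmk hφ x w₁ v w₂).trans ?_
  rw [hs.eq v w₁]
  rfl

end

end TangentStr

/-! ### The linear coordinates of an involution algebra -/

namespace SInvAlg

variable {X : SInvAlg.{u}}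

theorem coord_zero : coord (0 : X.carrier) = 0 := congrArg vec X.str.lift_zero

theorem contMDiff_coord :
    ContMDiff 𝓘(ℝ, X.model) 𝓘(ℝ, X.model) ∞ (coord : X.carrier → X.model) := by
  have h : ContMDiff 𝓘(ℝ, X.model) 𝓘(ℝ, X.model).tangent ∞
      (fun x : X.carrier => tmk 𝓘(ℝ, X.model) (0 : X.carrier) (coord x)) :=
    X.str.contMDiff_lift.congr fun x => (lift_eq x).symm
  intro x
  have h₂ := (Bundle.contMDiffAt_totalSpace.1 (h x)).2
  refine h₂.congr_of_eventuallyEq (Filter.Eventually.of_forall fun y => ?_)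
  exact (congrArg Prod.snd (trivializationAt_tmk (0 : X.carrier) (coord y))).symm

variable (X) in
/-- The inverse of the coordinates `SInvAlg.coord`. -/
noncomputable def ofCoord (e : X.model) : X.carrier :=
  X.str.vert (tmk 𝓘(ℝ, X.model) (0 : X.carrier) e)

theorem coord_ofCoord (e : X.model) : coord (X.ofCoord e) = e :=
  congrArg vec (lift_vert (tmk 𝓘(ℝ, X.model) (0 : X.carrier) e) rfl)

theorem ofCoord_coord (x : X.carrier) : X.ofCoord (coord x) = x :=
  coord_injective (coord_ofCoord _)

theorem contMDiff_ofCoord : ContMDiff 𝓘(ℝ, X.model) 𝓘(ℝ, X.model) ∞ X.ofCoord := by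
  have h : ContMDiff 𝓘(ℝ, X.model) 𝓘(ℝ, X.model).tangent ∞
      (fun e : X.model => tmk 𝓘(ℝ, X.model) (0 : X.carrier) e) := by
    intro e
    refine Bundle.contMDiffAt_totalSpace.2 ⟨contMDiffAt_const, ?_⟩
    refine contMDiffAt_id.congr_of_eventuallyEq (Filter.Eventually.of_forall fun y => ?_)
    exact congrArg Prod.snd (trivializationAt_tmk (0 : X.carrier) y)
  exact X.str.contMDiff_vert.comp h

/-- The coordinates have derivative `id` at `0`: this is what `T(λ)λ = lλ` says. -/
theorem tangentMap_coord_lift (x : X.carrier) :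
    tangentMap 𝓘(ℝ, X.model) 𝓘(ℝ, X.model) coord (X.str.lift x) =
      tmk 𝓘(ℝ, X.model) (0 : X.model) (coord x) := by
  let D : X.model →L[ℝ] X.model :=
    fderiv ℝ (localRep (E := X.model) (coord : X.carrier → X.model) 0)
      (chartAt X.model (0 : X.carrier) 0)
  have hD : HasFDerivAt (localRep (E := X.model) (coord : X.carrier → X.model) 0) D
      (chartAt X.model (0 : X.carrier) 0) :=
    ((contDiffAt_localRep contMDiff_coord (mem_chart_target X.model
      (0 : X.carrier))).differentiableAt (by simp)).hasFDerivAt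
  have hl : (X.str.lift : X.carrier → X.T) =
      fun y => tmk 𝓘(ℝ, X.model) (0 : X.carrier) (coord y) := funext lift_eq
  have h : HasMFDerivAt 𝓘(ℝ, X.model) 𝓘(ℝ, X.model).tangent
      (fun y => tmk 𝓘(ℝ, X.model) (0 : X.carrier) (coord y)) (0 : X.carrier)
      ((0 : X.model →L[ℝ] X.model).prod D) := by
    refine ⟨hl ▸ X.str.contMDiff_lift.continuous.continuousAt, ?_⟩
    have h₁ : writtenInExtChartAt 𝓘(ℝ, X.model) 𝓘(ℝ, X.model).tangent (0 : X.carrier)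
        (fun y => tmk 𝓘(ℝ, X.model) (0 : X.carrier) (coord y)) =
        fun z => (chartAt X.model (0 : X.carrier) 0,
          localRep (E := X.model) coord (0 : X.carrier) z) :=
      funext fun z => extChartAt_tmk (0 : X.carrier) (coord (0 : X.carrier)) _
    rw [h₁]
    exact ((hasFDerivAt_const _ _).prodMk hD).hasFDerivWithinAt
  -- The second-order vertical part of `T(λ)λ = lλ` is `D (coord x) = coord x`.
  have h₂ := X.str.lift_lift x
  rw [lift_eq x, hl] at h₂
  have h₃ := congrArg (fun t => (vec t : X.model × X.model).2) h₂
  have h₄ : (mfderiv 𝓘(ℝ, X.model) 𝓘(ℝ, X.model).tangent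
      (fun y => tmk 𝓘(ℝ, X.model) (0 : X.carrier) (coord y)) (0 : X.carrier) :
        X.model →L[ℝ] X.model × X.model) =
      (0 : X.model →L[ℝ] X.model).prod D := h.mfderiv
  have h₅ : D (coord x) = coord x :=
    (congrArg (fun K : X.model →L[ℝ] X.model × X.model => (K (coord x)).2) h₄).symm.trans h₃
  rw [lift_eq x, tangentMap_tmk contMDiff_coord, coord_zero]
  exact congrArg (tmk 𝓘(ℝ, X.model) (0 : X.model)) h₅

end SInvAlg

/-! ### Transport of an involution algebra to its coordinate space -/

section

variable {E : Type u} [NormedAddCommGroup E] [NormedSpace ℝ E]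
  {A : Type u} [TopologicalSpace A] [ChartedSpace E A] [IsManifold 𝓘(ℝ, E) ∞ A]
  {F : Type u} [NormedAddCommGroup F] [NormedSpace ℝ F]
  {B : Type u} [TopologicalSpace B] [ChartedSpace F B] [IsManifold 𝓘(ℝ, F) ∞ B]

theorem mdifferentiable_tangentMap {φ : A → B} (hφ : ContMDiff 𝓘(ℝ, E) 𝓘(ℝ, F) ∞ φ) :
    MDifferentiable 𝓘(ℝ, E).tangent 𝓘(ℝ, F).tangent (tangentMap 𝓘(ℝ, E) 𝓘(ℝ, F) φ) :=
  (hφ.contMDiff_tangentMap (m := ∞) (mod_cast le_rfl)).mdifferentiable (by simp)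

/-- A smooth map which intertwines `α` and `β` also intertwines `T(α)` and `T(β)`. -/
theorem tangentMap_tangentFlip {φ : A → B} (hφ : ContMDiff 𝓘(ℝ, E) 𝓘(ℝ, F) ∞ φ)
    {α : A × TangentBundle 𝓘(ℝ, E) A → TangentBundle 𝓘(ℝ, E) A}
    (hα : ContMDiff (𝓘(ℝ, E).prod 𝓘(ℝ, E).tangent) 𝓘(ℝ, E).tangent ∞ α)
    {β : B × TangentBundle 𝓘(ℝ, F) B → TangentBundle 𝓘(ℝ, F) B}
    (hβ : ContMDiff (𝓘(ℝ, F).prod 𝓘(ℝ, F).tangent) 𝓘(ℝ, F).tangent ∞ β)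
    (h : ∀ v w, tangentMap 𝓘(ℝ, E) 𝓘(ℝ, F) φ (α (v, w)) =
      β (φ v, tangentMap 𝓘(ℝ, E) 𝓘(ℝ, F) φ w))
    (s : TangentBundle 𝓘(ℝ, E) A) (t : TangentBundle 𝓘(ℝ, E).tangent (TangentBundle 𝓘(ℝ, E) A)) :
    tangentMap 𝓘(ℝ, E).tangent 𝓘(ℝ, F).tangent (tangentMap 𝓘(ℝ, E) 𝓘(ℝ, F) φ)
        (tangentFlip E A α s t) =
      tangentFlip F B β (tangentMap 𝓘(ℝ, E) 𝓘(ℝ, F) φ s)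
        (tangentMap 𝓘(ℝ, E).tangent 𝓘(ℝ, F).tangent (tangentMap 𝓘(ℝ, E) 𝓘(ℝ, F) φ) t) := by
  have hφ' : MDifferentiable 𝓘(ℝ, E) 𝓘(ℝ, F) φ := hφ.mdifferentiable (by simp)
  have hTφ := mdifferentiable_tangentMap hφ
  let p := (equivTangentBundleProd 𝓘(ℝ, E) A 𝓘(ℝ, E).tangent (TangentBundle 𝓘(ℝ, E) A)).symm (s, t)
  have h₁ := tangentMap_comp_at p (hTφ _) (hα.mdifferentiable (by simp) _)
  have h₂ := tangentMap_comp_at p (hβ.mdifferentiable (by simp) _) ((hφ'.prodMap hTφ) _)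
  have h₃ : tangentMap 𝓘(ℝ, E) 𝓘(ℝ, F) φ ∘ α =
      β ∘ Prod.map φ (tangentMap 𝓘(ℝ, E) 𝓘(ℝ, F) φ) := funext fun q => h q.1 q.2
  refine h₁.symm.trans ((congrArg (fun g => tangentMap _ _ g p) h₃).trans (h₂.trans ?_))
  refine congrArg (tangentMap _ _ _) (Bundle.TotalSpace.ext rfl (heq_of_eq ?_))
  exact congrArg (fun D : E × E × E →L[ℝ] F × F × F => D p.2) (mfderiv_prodMap (hφ' s.1) (hTφ t.1))

end

namespace SInvAlg

variable {X : SInvAlg.{u}}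

variable (X) in
/-- The tangent map of the coordinates. -/
noncomputable abbrev tcoord : X.T → TangentBundle 𝓘(ℝ, X.model) X.model :=
  tangentMap 𝓘(ℝ, X.model) 𝓘(ℝ, X.model) coord

variable (X) in
/-- The second tangent map of the coordinates. -/
noncomputable abbrev ttcoord : TangentBundle 𝓘(ℝ, X.model).tangent X.T →
    TangentBundle 𝓘(ℝ, X.model).tangent (TangentBundle 𝓘(ℝ, X.model) X.model) :=
  tangentMap 𝓘(ℝ, X.model).tangent 𝓘(ℝ, X.model).tangent X.tcoord

variable (X) in
/-- The tangent map of the inverse of the coordinates. -/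
noncomputable abbrev tofCoord : TangentBundle 𝓘(ℝ, X.model) X.model → X.T :=
  tangentMap 𝓘(ℝ, X.model) 𝓘(ℝ, X.model) X.ofCoord

theorem tofCoord_tcoord (t : X.T) : X.tofCoord (X.tcoord t) = t := by
  have h := tangentMap_comp_at t (contMDiff_ofCoord.mdifferentiable (by simp) _)
    (contMDiff_coord.mdifferentiable (by simp) _)
  rw [show X.ofCoord ∘ coord = id from funext ofCoord_coord, tangentMap_id] at h
  exact h.symm

theorem tcoord_tofCoord (t : TangentBundle 𝓘(ℝ, X.model) X.model) :
    X.tcoord (X.tofCoord t) = t := by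
  have h := tangentMap_comp_at t (contMDiff_coord.mdifferentiable (by simp) _)
    (contMDiff_ofCoord.mdifferentiable (by simp) _)
  rw [show coord ∘ X.ofCoord = id from funext coord_ofCoord, tangentMap_id] at h
  exact h.symm

theorem exists_tcoord (w : TangentBundle 𝓘(ℝ, X.model) X.model) : ∃ t, w = X.tcoord t :=
  ⟨_, (tcoord_tofCoord w).symm⟩

theorem exists_ttcoord
    (x : TangentBundle 𝓘(ℝ, X.model).tangent (TangentBundle 𝓘(ℝ, X.model) X.model)) :
    ∃ t, x = X.ttcoord t := by
  have h := tangentMap_comp_at x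
    (mdifferentiable_tangentMap (contMDiff_coord (X := X)) _)
    (mdifferentiable_tangentMap (contMDiff_ofCoord (X := X)) _)
  rw [show X.tcoord ∘ X.tofCoord = id from funext tcoord_tofCoord, tangentMap_id] at h
  exact ⟨_, h⟩

variable (X) in
/-- The flip of an involution algebra in the linear coordinates. -/
noncomputable def coordFlip (q : X.model × TangentBundle 𝓘(ℝ, X.model) X.model) :
    TangentBundle 𝓘(ℝ, X.model) X.model :=
  X.tcoord (X.str.flip (X.ofCoord q.1, X.tofCoord q.2))

theorem coordFlip_coord (v : X.carrier) (w : X.T) :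
    X.coordFlip (coord v, X.tcoord w) = X.tcoord (X.str.flip (v, w)) := by
  rw [coordFlip, ofCoord_coord, tofCoord_tcoord]

theorem contMDiff_coordFlip :
    ContMDiff (𝓘(ℝ, X.model).prod 𝓘(ℝ, X.model).tangent) 𝓘(ℝ, X.model).tangent ∞ X.coordFlip := by
  have h₁ := (contMDiff_coord (X := X)).contMDiff_tangentMap (m := ∞) (mod_cast le_rfl)
  have h₂ := (contMDiff_ofCoord (X := X)).contMDiff_tangentMap (m := ∞) (mod_cast le_rfl)
  exact (h₁.comp X.str.contMDiff_flip).comp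
    ((contMDiff_ofCoord.comp contMDiff_fst).prodMk (h₂.comp contMDiff_snd))

theorem ttcoord_tangentFlip (s : X.T) (t : TangentBundle 𝓘(ℝ, X.model).tangent X.T) :
    X.ttcoord (tangentFlip X.model X.carrier X.str.flip s t) =
      tangentFlip X.model X.model X.coordFlip (X.tcoord s) (X.ttcoord t) :=
  tangentMap_tangentFlip contMDiff_coord X.str.contMDiff_flip contMDiff_coordFlip
    (fun v w => (coordFlip_coord v w).symm) s t

theorem tcoord_zero (x : X.carrier) : X.tcoord (TangentStr.zero 𝓘(ℝ, X.model) x) =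
    TangentStr.zero 𝓘(ℝ, X.model) (coord x) :=
  tangentMap_zero x

theorem tcoord_lift (x : X.carrier) :
    X.tcoord (X.str.lift x) = tmk 𝓘(ℝ, X.model) (0 : X.model) (coord x) :=
  tangentMap_coord_lift x

theorem ttcoord_vlift (t : X.T) : X.ttcoord (vlift t) = vlift (X.tcoord t) :=
  tangentMap_vlift contMDiff_coord t

theorem ttcoord_cflip (t : TangentBundle 𝓘(ℝ, X.model).tangent X.T) :
    X.ttcoord (cflip t) = cflip (X.ttcoord t) :=
  tangentMap_cflip contMDiff_coord t

/-- The coordinates intertwine the tangent maps of the lifts of `X` and of its model space. -/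
theorem tangentMap_lift_tcoord (w : X.T) :
    tangentMap 𝓘(ℝ, X.model) 𝓘(ℝ, X.model).tangent
      (fun e : X.model => tmk 𝓘(ℝ, X.model) (0 : X.model) e) (X.tcoord w) =
    X.ttcoord (tangentMap 𝓘(ℝ, X.model) 𝓘(ℝ, X.model).tangent X.str.lift w) := by
  have h₁ := tangentMap_comp_at w
    ((contMDiff_mk (V := X.model) (contMDiff_const (c := (0 : X.model)))
      contMDiff_id).mdifferentiable (by simp) _)
    ((contMDiff_coord (X := X)).mdifferentiable (by simp) _)
  have h₂ := tangentMap_comp_at w (mdifferentiable_tangentMap (contMDiff_coord (X := X)) _)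
    (X.str.contMDiff_lift.mdifferentiable (by simp) _)
  refine h₁.symm.trans (Eq.trans (congrArg (fun g => tangentMap _ _ g w) ?_) h₂)
  exact funext fun x => (tangentMap_coord_lift x).symm

variable (X) in
/-- The involution structure on the coordinate space. -/
noncomputable def coordStructure : InvolutionStructure X.model X.model where
  toDifferentialObject :=
    (bilinStructure (0 : X.model →L[ℝ] X.model →L[ℝ] X.model) (fun _ => rfl)
      (fun _ _ _ => (add_zero 0).symm)).toDifferentialObject
  flip := X.coordFlip
  contMDiff_flip := contMDiff_coordFlip
  proj_flip v w := (congrArg coord (X.str.proj_flip _ _)).trans (coord_ofCoord v)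
  flip_linear v w := by
    obtain ⟨v, rfl⟩ : ∃ x : X.carrier, v = coord x := ⟨_, (coord_ofCoord v).symm⟩
    obtain ⟨w, rfl⟩ := exists_tcoord w
    refine (congrArg (fun t => tangentFlip X.model X.model X.coordFlip
      (TangentStr.zero 𝓘(ℝ, X.model) (coord v)) (cflip t)) (tangentMap_lift_tcoord w)).trans ?_
    rw [← tcoord_zero, ← ttcoord_cflip, ← ttcoord_tangentFlip,
      X.str.flip_linear, coordFlip_coord, ttcoord_vlift]
  flip_linear' v w := by
    obtain ⟨v, rfl⟩ : ∃ x : X.carrier, v = coord x := ⟨_, (coord_ofCoord v).symm⟩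
    obtain ⟨w, rfl⟩ := exists_tcoord w
    rw [coordFlip_coord]
    refine Eq.trans ?_ (congrArg cflip (tangentMap_lift_tcoord (X.str.flip (v, w)))).symm
    rw [← ttcoord_cflip, ← X.str.flip_linear', ttcoord_tangentFlip,
      tcoord_lift, ttcoord_vlift]
    rfl
  flip_unit v := by
    obtain ⟨v, rfl⟩ : ∃ x : X.carrier, v = coord x := ⟨_, (coord_ofCoord v).symm⟩
    have h := coordFlip_coord 0 (X.str.lift v)
    rw [X.str.flip_unit, tcoord_lift, coord_zero] at h
    exact h
  flip_inv v w := by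
    obtain ⟨v, rfl⟩ : ∃ x : X.carrier, v = coord x := ⟨_, (coord_ofCoord v).symm⟩
    obtain ⟨w, rfl⟩ := exists_tcoord w
    rw [coordFlip_coord]
    exact (coordFlip_coord w.proj _).trans (congrArg X.tcoord (X.str.flip_inv v w))
  flip_flip v w x := by
    obtain ⟨v, rfl⟩ : ∃ x : X.carrier, v = coord x := ⟨_, (coord_ofCoord v).symm⟩
    obtain ⟨w, rfl⟩ := exists_tcoord w
    obtain ⟨x, rfl⟩ := exists_ttcoord x
    have h : X.coordFlip (coord v, (X.ttcoord x).proj) = X.tcoord (X.str.flip (v, x.proj)) :=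
      coordFlip_coord v x.proj
    rw [h, coordFlip_coord, ← ttcoord_tangentFlip, X.str.flip_flip,
      ttcoord_cflip, ttcoord_tangentFlip, ttcoord_cflip,
      ttcoord_tangentFlip, ttcoord_cflip]

end SInvAlg

/-! ### Involution structures on a vector space -/

namespace InvolutionStructure

variable {V : Type u} [NormedAddCommGroup V] [NormedSpace ℝ V] (S : InvolutionStructure V V)

/-- The vertical part `G(v, h, k)` of the flip `α(v, (h, k)) = (v, G(v, h, k))`. -/
noncomputable def flipVec (q : V × V × V) : V := vec (S.flip (q.1, tmk 𝓘(ℝ, V) q.2.1 q.2.2))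

theorem flip_eq (v : V) (w : TangentBundle 𝓘(ℝ, V) V) :
    S.flip (v, w) = tmk 𝓘(ℝ, V) v (S.flipVec (v, w.1, vec w)) :=
  Bundle.TotalSpace.ext (S.proj_flip v w) HEq.rfl

theorem contDiff_flipVec : ContDiff ℝ ∞ S.flipVec := by
  rw [← contMDiff_iff_contDiff]
  have h₁ : ContMDiff 𝓘(ℝ, V × V × V) 𝓘(ℝ, V) ∞ (fun q : V × V × V => q.1) :=
    contDiff_fst.contMDiff
  have h₂ : ContMDiff 𝓘(ℝ, V × V × V) 𝓘(ℝ, V) ∞ (fun q : V × V × V => q.2.1) :=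
    (contDiff_fst.comp contDiff_snd).contMDiff
  have h₃ : ContMDiff 𝓘(ℝ, V × V × V) 𝓘(ℝ, V) ∞ (fun q : V × V × V => q.2.2) :=
    (contDiff_snd.comp contDiff_snd).contMDiff
  exact contMDiff_vec.comp (S.contMDiff_flip.comp (h₁.prodMk (contMDiff_mk h₂ h₃)))

theorem tangentFlip_tmk (x s : V) (y : TangentBundle 𝓘(ℝ, V) V) (t : V × V) :
    tangentFlip V V S.flip (tmk 𝓘(ℝ, V) x s) (tmk 𝓘(ℝ, V).tangent y t) =
      tmk 𝓘(ℝ, V).tangent (S.flip (x, y))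
        (s, fderiv ℝ S.flipVec (x, y.1, vec y) (s, t)) := by
  have h := (S.contDiff_flipVec.differentiable (by simp) (x, y.1, vec y)).hasFDerivAt
  exact tangentFlip_mk S.flip S.contMDiff_flip.continuous (fun q => (q.1, S.flipVec q))
    (fun q => ⟨S.proj_flip _ _, rfl⟩) x s y t _ (hasFDerivAt_fst.prodMk h)

variable {S}

/-- The first linearity axiom: `G(v, -, -)` is its own derivative at `0`. -/
theorem flipVec_eq_fderiv (hS : S.lift = fun e : V => tmk 𝓘(ℝ, V) (0 : V) e)
    (v h k : V) :
    S.flipVec (v, h, k) = fderiv ℝ S.flipVec (v, 0, 0) (0, h, k) := by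
  have H := S.flip_linear v (tmk 𝓘(ℝ, V) h k)
  rw [hS, tangentMap_zero_section] at H
  have H' := (S.tangentFlip_tmk v 0 (tmk 𝓘(ℝ, V) 0 0) (h, k)).symm.trans H
  exact (congrArg (fun t => (vec t : V × V).2) H').symm

/-- The second linearity axiom: `G(-, h, -)` is its own derivative at `0`. -/
theorem flipVec_eq_fderiv' (hS : S.lift = fun e : V => tmk 𝓘(ℝ, V) (0 : V) e)
    (v h k : V) :
    S.flipVec (v, h, k) = fderiv ℝ S.flipVec (0, h, 0) (v, 0, k) := by
  have H := S.flip_linear' v (tmk 𝓘(ℝ, V) h k)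
  rw [S.flip_eq v (tmk 𝓘(ℝ, V) h k), hS, tangentMap_zero_section] at H
  have H' := (S.tangentFlip_tmk 0 v (tmk 𝓘(ℝ, V) h 0) (0, k)).symm.trans H
  exact (congrArg (fun t => (vec t : V × V).2) H').symm

/-- By linearity in `(h, k)` and in `(v, k)`, and `G(0, 0, k) = k`, the flip is a translation of the
vertical part. -/
theorem flipVec_eq_add (hS : S.lift = fun e : V => tmk 𝓘(ℝ, V) (0 : V) e)
    (v h k : V) : S.flipVec (v, h, k) = k + S.flipVec (v, h, 0) := by
  have h₁ : S.flipVec (v, h, k) = S.flipVec (0, h, k) + S.flipVec (v, h, 0) := by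
    rw [flipVec_eq_fderiv' hS v h k, flipVec_eq_fderiv' hS v h 0, flipVec_eq_fderiv' hS 0 h k,
      ← map_add]
    simp
  have h₂ : S.flipVec (0, h, k) = S.flipVec (0, 0, k) + S.flipVec (0, h, 0) := by
    rw [flipVec_eq_fderiv hS 0 h k, flipVec_eq_fderiv hS 0 h 0, flipVec_eq_fderiv hS 0 0 k,
      ← map_add]
    simp
  have h₃ : S.flipVec (0, h, 0) = 0 := by
    rw [flipVec_eq_fderiv' hS 0 h 0]
    exact map_zero _
  have h₄ : S.flipVec (0, 0, k) = k := by
    have H := S.flip_unit k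
    rw [hS] at H
    exact congrArg vec H
  rw [h₁, h₂, h₃, h₄, add_zero]

/-- On a finite-dimensional vector space with its standard lift, every involution structure is
that of a Lie bracket. -/
theorem exists_bracket [FiniteDimensional ℝ V]
    (hS : S.lift = fun e : V => tmk 𝓘(ℝ, V) (0 : V) e) : ∃ B : V →L[ℝ] V →L[ℝ] V,
    (S.flip = fun q => tmk 𝓘(ℝ, V) q.1 (vec q.2 + B q.1 q.2.1)) ∧
    (∀ x y, B x y = - B y x) ∧ ∀ x y z, B (B x y) z = B (B x z) y + B x (B y z) := by
  let L : V →ₗ[ℝ] V →ₗ[ℝ] V := LinearMap.mk₂ ℝ (fun v h => S.flipVec (v, h, 0))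
    (fun v v' h => by
      simp only [flipVec_eq_fderiv' hS _ h 0, ← map_add]
      simp)
    (fun c v h => by
      simp only [flipVec_eq_fderiv' hS _ h 0, ← map_smul]
      simp)
    (fun v h h' => by
      simp only [flipVec_eq_fderiv hS v _ 0, ← map_add]
      simp)
    (fun c v h => by
      simp only [flipVec_eq_fderiv hS v _ 0, ← map_smul]
      simp)
  let B : V →L[ℝ] V →L[ℝ] V := L.toContinuousBilinearMap
  have hB : ∀ v h, B v h = S.flipVec (v, h, 0) := fun v h => rfl
  have hflip : S.flip = fun q => tmk 𝓘(ℝ, V) q.1 (vec q.2 + B q.1 q.2.1) := by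
    funext q
    rw [S.flip_eq q.1 q.2, flipVec_eq_add hS, hB]
  have hanti : ∀ x y, B x y = - B y x := by
    intro x y
    have H := congrArg vec (S.flip_inv x (tmk 𝓘(ℝ, V) y 0))
    rw [hflip] at H
    have H' : (0 : V) + B x y + B y x = 0 := H
    rw [zero_add] at H'
    exact eq_neg_of_add_eq_zero_left H'
  refine ⟨B, hflip, hanti, fun x y z => ?_⟩
  -- With all remaining coordinates `0`, the second-order vertical part of the axiom is the Jacobi
  -- identity for `x`, `y`, `z`.
  have H := S.flip_flip x (tmk 𝓘(ℝ, V) y 0) (tmk 𝓘(ℝ, V).tangent (tmk 𝓘(ℝ, V) z 0) (0, 0))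
  rw [hflip] at H
  have h₁ := tangentFlip_bilin B x (0 + B x y) (tmk 𝓘(ℝ, V) z 0) (0, 0)
  have h₂ := tangentFlip_bilin B y 0 (tmk 𝓘(ℝ, V) z 0) (0, 0)
  have h₃ := tangentFlip_bilin B x (0 + B x z) (tmk 𝓘(ℝ, V) y 0) (0 + B y z, 0 + (B y 0 + B 0 z))
  have h₄ := (h₁.symm.trans H).trans (congrArg cflip ((congrArg (tangentFlip V V
    (fun q => tmk 𝓘(ℝ, V) q.1 (vec q.2 + B q.1 q.2.1)) (tmk 𝓘(ℝ, V) x (0 + B x z)))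
      (congrArg cflip h₂)).trans h₃))
  have h₅ : (0 : V) + (B x 0 + B (0 + B x y) z) =
      0 + (B y 0 + B 0 z) + (B x (0 + B y z) + B (0 + B x z) y) :=
    congrArg (fun t => (vec t : V × V).2) h₄
  simp only [map_zero, zero_add, _root_.zero_apply, add_zero] at h₅
  rw [h₅, add_comm]

end InvolutionStructure

/-! ### The bracket in coordinates, and morphisms from linear maps -/

namespace SInvAlg

variable {X Y : SInvAlg.{u}}

variable (X) in
/-- The involution algebra `X` transported to its coordinate space. -/
noncomputable def coordAlg : SInvAlg.{u} where
  carrier := X.model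
  model := X.model
  secondCountable :=
    haveI := FiniteDimensional.proper ℝ X.model
    secondCountable_of_proper
  str := X.coordStructure

variable (X) in
/-- The coordinates as a morphism of involution algebras. -/
noncomputable def toCoordAlg : X ⟶ X.coordAlg where
  toFun := coord
  contMDiff_toFun := contMDiff_coord
  map_lift := tcoord_lift
  map_flip v w := (coordFlip_coord v w).symm

variable (X) in
/-- The inverse of the coordinates as a morphism of involution algebras. -/
noncomputable def ofCoordAlg : X.coordAlg ⟶ X where
  toFun := X.ofCoord
  contMDiff_toFun := contMDiff_ofCoord
  map_lift e := by
    obtain ⟨x, rfl⟩ : ∃ x : X.carrier, e = coord x := ⟨_, (coord_ofCoord e).symm⟩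
    refine (congrArg X.tofCoord (tcoord_lift x).symm).trans ?_
    rw [tofCoord_tcoord]
    exact congrArg X.str.lift (ofCoord_coord x).symm
  map_flip _ _ := tofCoord_tcoord _

/-- In the linear coordinates the flip of every involution algebra is that of a Lie bracket. -/
theorem exists_coord_bracket (X : SInvAlg.{u}) : ∃ B : X.model →L[ℝ] X.model →L[ℝ] X.model,
    (X.coordFlip = fun q => tmk 𝓘(ℝ, X.model) q.1 (vec q.2 + B q.1 q.2.1)) ∧
    (∀ x y : X.carrier, coord (X.bracket x y) = B (coord x) (coord y)) ∧
    (∀ x y, B x y = - B y x) ∧ ∀ x y z, B (B x y) z = B (B x z) y + B x (B y z) := by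
  obtain ⟨B, hB, h₁, h₂⟩ := InvolutionStructure.exists_bracket (S := X.coordStructure) rfl
  refine ⟨B, hB, fun x y => ?_, h₁, h₂⟩
  refine (map_bracket X.toCoordAlg x y).trans ?_
  have h₃ : X.coordStructure.mu (coord y) (0 : X.model) = tmk 𝓘(ℝ, X.model) (coord y) 0 :=
    (tangentAdd_mk (coord y) 0 0 0).trans (by rw [add_zero, add_zero])
  have h₄ : vec (X.coordStructure.flip (coord x, X.coordStructure.mu (coord y) (0 : X.model))) =
      B (coord x) (coord y) := by
    rw [h₃, hB]
    exact zero_add _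
  exact h₄

/-- The identities of the bracket hold because they hold in the linear coordinates. -/
theorem bracketIsLie (X : SInvAlg.{u}) : X.BracketIsLie := by
  obtain ⟨B, -, hB, h₁, h₂⟩ := exists_coord_bracket X
  have hneg : ∀ x : X.carrier, coord (-x) = - coord x := fun x => by
    rw [← neg_one_smul ℝ x, coord_smul, neg_one_smul]
  constructor
  · exact fun x y z => coord_injective (by simp only [hB, coord_add, map_add, _root_.add_apply])
  · exact fun x y z => coord_injective (by simp only [hB, coord_add, map_add])
  · exact fun r x y => coord_injective (by simp only [hB, coord_smul, map_smul, _root_.smul_apply])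
  · exact fun r x y => coord_injective (by simp only [hB, coord_smul, map_smul])
  · exact fun x y => coord_injective (by rw [hneg, hB, hB, h₁])
  · exact fun x y z => coord_injective (by simp only [hB, coord_add]; exact h₂ _ _ _)

variable (X) in
/-- The coordinates as a linear equivalence. -/
noncomputable def coordEquiv : X.carrier ≃ₗ[ℝ] X.model where
  toFun := coord
  map_add' := coord_add
  map_smul' := coord_smul
  invFun := X.ofCoord
  left_inv := ofCoord_coord
  right_inv := coord_ofCoord

/-- Conjugation with the coordinates turns a linear map into a continuous linear map between the
model spaces, which is smooth and its own derivative; so a linear map which preserves the brackets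
underlies a morphism. -/
theorem exists_hom_toFun_eq (f : X.carrier →ₗ[ℝ] Y.carrier)
    (hf : ∀ x y, f (X.bracket x y) = Y.bracket (f x) (f y)) : ∃ g : X ⟶ Y, g.toFun = f := by
  obtain ⟨B, hBα, hB, -⟩ := exists_coord_bracket X
  obtain ⟨C, hCα, hC, -⟩ := exists_coord_bracket Y
  let L : X.model →L[ℝ] Y.model := LinearMap.toContinuousLinearMap
    (Y.coordEquiv.toLinearMap ∘ₗ f ∘ₗ X.coordEquiv.symm.toLinearMap)
  have hL : ∀ x : X.carrier, L (coord x) = coord (f x) := fun x =>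
    congrArg (fun y => coord (f y)) (ofCoord_coord x)
  have hLB : ∀ v w, L (B v w) = C (L v) (L w) := by
    intro v w
    obtain ⟨v, rfl⟩ : ∃ x : X.carrier, v = coord x := ⟨_, (coord_ofCoord v).symm⟩
    obtain ⟨w, rfl⟩ : ∃ x : X.carrier, w = coord x := ⟨_, (coord_ofCoord w).symm⟩
    rw [← hB, hL, hL, hL, hf, hC]
  have hflip : ∀ v w, tangentMap 𝓘(ℝ, X.model) 𝓘(ℝ, Y.model) L (X.coordFlip (v, w)) =
      Y.coordFlip (L v, tangentMap 𝓘(ℝ, X.model) 𝓘(ℝ, Y.model) L w) := by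
    intro v w
    rw [tangentMap_clm L w, tangentMap_clm, hBα, hCα]
    exact congrArg (tmk 𝓘(ℝ, Y.model) (L v)) ((map_add L _ _).trans (by rw [hLB]; rfl))
  let m : X.coordAlg ⟶ Y.coordAlg :=
    { toFun := L
      contMDiff_toFun := L.contMDiff
      map_lift := fun x =>
        (tangentMap_clm L (tmk 𝓘(ℝ, X.model) (0 : X.model) x)).trans
          (congrArg (fun y => tmk 𝓘(ℝ, Y.model) y (L x)) (map_zero L))
      map_flip := hflip }
  refine ⟨X.toCoordAlg ≫ m ≫ Y.ofCoordAlg, funext fun x => ?_⟩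
  exact (congrArg Y.ofCoord (hL x)).trans (ofCoord_coord (f x))

/-- A linear map which preserves the brackets is a morphism of involution algebras. -/
noncomputable def homOfLinear (f : X.carrier →ₗ[ℝ] Y.carrier)
    (hf : ∀ x y, f (X.bracket x y) = Y.bracket (f x) (f y)) : X ⟶ Y where
  toFun := f
  contMDiff_toFun := by
    obtain ⟨g, hg⟩ := exists_hom_toFun_eq f hf
    exact hg ▸ g.contMDiff_toFun
  map_lift := by
    obtain ⟨g, hg⟩ := exists_hom_toFun_eq f hf
    exact hg ▸ g.map_lift
  map_flip := by
    obtain ⟨g, hg⟩ := exists_hom_toFun_eq f hf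
    exact hg ▸ g.map_flip

/-- A linear equivalence which preserves the brackets is an isomorphism of involution algebras. -/
noncomputable def isoOfLinear (f : X.carrier ≃ₗ[ℝ] Y.carrier)
    (hf : ∀ x y, f (X.bracket x y) = Y.bracket (f x) (f y)) : X ≅ Y where
  hom := homOfLinear f.toLinearMap hf
  inv := homOfLinear f.symm.toLinearMap fun x y => f.injective (by
    change f (f.symm _) = f (X.bracket (f.symm x) (f.symm y))
    rw [hf]
    simp only [LinearEquiv.apply_symm_apply])
  hom_inv_id := Hom.ext (funext f.symm_apply_apply)
  inv_hom_id := Hom.ext (funext f.apply_symm_apply)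

end SInvAlg

/-! ### The two functors are mutually inverse -/

namespace LieAlg

theorem toInvolution_mu (A : LieAlg.{u}) (a b : A.carrier) :
    (toInvolution.obj A).str.mu a b =
      letI := A.normedAddCommGroup
      letI := A.normedSpace
      tmk 𝓘(ℝ, A.carrier) a b := by
  let := A.normedAddCommGroup
  let := A.normedSpace
  exact (tangentAdd_mk a 0 0 b).trans (by rw [add_zero, zero_add])

theorem toInvolution_flip (A : LieAlg.{u}) (v wH wV : A.carrier) :
    (toInvolution.obj A).str.flip (v, (toInvolution.obj A).str.mu wH wV) =
      (toInvolution.obj A).str.mu v (wV + ⁅v, wH⁆) := by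
  rw [toInvolution_mu, toInvolution_mu]
  rfl

theorem toInvolution_bracket (A : LieAlg.{u}) (x y : A.carrier) :
    (toInvolution.obj A).bracket x y = ⁅x, y⁆ := by
  have h := toInvolution_flip A x y 0
  rw [zero_add] at h
  exact (congrArg (toInvolution.obj A).str.vert h).trans ((toInvolution.obj A).str.vert_mu _ _)

/-- The scalar multiplication recovered from the lift of `ι(A)` is that of `A`. -/
theorem toInvolution_smul (A : LieAlg.{u}) (r : ℝ) (x : A.carrier) :
    (r • (show (toInvolution.obj A).carrier from x)) = r • x := rfl

/-- Lie algebras on the same set with the same operations are equal. -/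
theorem mk_eq_mk {C : Type u} {r r' : LieRing C} {a : @LieAlgebra ℝ C _ r}
    {a' : @LieAlgebra ℝ C _ r'} {h h'} (hadd : r.toAddCommGroup = r'.toAddCommGroup)
    (hr : ∀ x y, r.bracket x y = r'.bracket x y)
    (ha : ∀ c x, a.smul c x = a'.smul c x) :
    @LieAlg.mk C r a h = @LieAlg.mk C r' a' h' := by
  have : r = r' := by
    obtain @⟨g, ⟨b⟩⟩ := r
    obtain @⟨g', ⟨b'⟩⟩ := r'
    cases hadd
    obtain rfl : b = b' := funext₂ hr
    rfl
  subst this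
  have : a = a' := LieAlgebra.ext (congrArg (fun m : Module ℝ C => m.smul) (Module.ext' _ _ ha))
  subst this
  rfl

end LieAlg

namespace LieAlg

theorem toInvolution_comp_toLie_obj (h : ∀ X : SInvAlg.{u}, X.BracketIsLie) (A : LieAlg.{u}) :
    (toInvolution ⋙ SInvAlg.toLie h).obj A = A :=
  mk_eq_mk (r' := A.lieRing) (a' := A.lieAlgebra) (h' := A.finiteDimensional) rfl
    (toInvolution_bracket A) (toInvolution_smul A)

/-- Arrows of `LieAlg` over equal objects are equal if their underlying maps are. -/
theorem heq_of_apply_eq {C D : Type u} {r r' : LieRing C} {a : @LieAlgebra ℝ C _ r}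
    {a' : @LieAlgebra ℝ C _ r'} {h h'} {s s' : LieRing D} {b : @LieAlgebra ℝ D _ s}
    {b' : @LieAlgebra ℝ D _ s'} {k k'}
    (hC : @LieAlg.mk C r a h = @LieAlg.mk C r' a' h')
    (hD : @LieAlg.mk D s b k = @LieAlg.mk D s' b' k')
    (f : @LieAlg.mk C r a h ⟶ @LieAlg.mk D s b k)
    (g : @LieAlg.mk C r' a' h' ⟶ @LieAlg.mk D s' b' k')
    (hfg : ∀ x, (show @LieHom ℝ C D _ r a s b from f) x =
      (show @LieHom ℝ C D _ r' a' s' b' from g) x) : HEq f g := by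
  cases hC
  cases hD
  exact heq_of_eq (LieHom.ext hfg)

theorem toInvolution_comp_toLie (h : ∀ X : SInvAlg.{u}, X.BracketIsLie) :
    toInvolution ⋙ SInvAlg.toLie h = 𝟭 LieAlg.{u} :=
  Functor.hext (toInvolution_comp_toLie_obj h) fun A B f =>
    heq_of_apply_eq (r' := A.lieRing) (a' := A.lieAlgebra) (h' := A.finiteDimensional)
      (s' := B.lieRing) (b' := B.lieAlgebra) (k' := B.finiteDimensional)
      (toInvolution_comp_toLie_obj h A) (toInvolution_comp_toLie_obj h B) _ f fun _ => rfl

end LieAlg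

namespace SInvAlg

/-- The identity map of `X` as a linear equivalence from the involution algebra of its Lie
algebra. -/
noncomputable def toLieEquiv (h : ∀ X : SInvAlg.{u}, X.BracketIsLie) (X : SInvAlg.{u}) :
    ((toLie h ⋙ LieAlg.toInvolution).obj X).carrier ≃ₗ[ℝ] X.carrier where
  toFun x := x
  map_add' _ _ := rfl
  map_smul' _ _ := rfl
  invFun x := x
  left_inv _ := rfl
  right_inv _ := rfl

/-- The identity maps form a natural isomorphism from `ι ∘ r` to the identity functor. -/
noncomputable def toLieCompToInvolutionIso (h : ∀ X : SInvAlg.{u}, X.BracketIsLie) :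
    toLie h ⋙ LieAlg.toInvolution ≅ 𝟭 SInvAlg.{u} :=
  NatIso.ofComponents
    (fun X => isoOfLinear (toLieEquiv h X) (LieAlg.toInvolution_bracket (toLieAlg (h X))))
    (fun _ => Hom.ext rfl)

end SInvAlg

/-- The functor `ι` from Lie algebras to smooth involution algebras, which sends a Lie algebra to
the flip `α(v, w_H, w_V) = (v, w_V + [v, w_H])` and is the identity on arrows, is an equivalence of
categories. On every smooth involution algebra `[x, y] = π₁α(x, y, 0)` is a Lie bracket, and the
resulting functor `r`, the identity on arrows, is a retraction of `ι` that is inverse to `ι`: the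
identity maps `ι(r(X)) → X` are a natural isomorphism. -/
theorem mainTheorem4 :
    LieAlg.toInvolution.{u}.IsEquivalence ∧
    (∀ (A : LieAlg.{u}) (v wH wV : A.carrier),
      (LieAlg.toInvolution.obj A).str.flip (v, (LieAlg.toInvolution.obj A).str.mu wH wV) =
        (LieAlg.toInvolution.obj A).str.mu v (wV + ⁅v, wH⁆)) ∧
    (∀ (A B : LieAlg.{u}) (f : A.carrier →ₗ⁅ℝ⁆ B.carrier) (x : A.carrier),
      (LieAlg.toInvolution.map (X := A) (Y := B) f).toFun x = f x) ∧
    ∃ h : ∀ X : SInvAlg.{u}, X.BracketIsLie,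
      LieAlg.toInvolution ⋙ SInvAlg.toLie h = 𝟭 LieAlg.{u} ∧
      ∃ ε : SInvAlg.toLie h ⋙ LieAlg.toInvolution ≅ 𝟭 SInvAlg.{u},
        ∀ (X : SInvAlg.{u}) (x : X.carrier), (ε.hom.app X).toFun x = x := by
  let h : ∀ X : SInvAlg.{u}, X.BracketIsLie := SInvAlg.bracketIsLie
  let ε := SInvAlg.toLieCompToInvolutionIso h
  have hr := LieAlg.toInvolution_comp_toLie h
  exact ⟨(CategoryTheory.Equivalence.mk LieAlg.toInvolution (SInvAlg.toLie h) (eqToIso hr.symm)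
    ε).isEquivalence_functor, LieAlg.toInvolution_flip, fun _ _ _ _ => rfl, h, hr, ε,
    fun _ _ => rfl⟩
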